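/- Let $d\ge 2$, let $\Omega\subset\mathbb R^d$ be a bounded open set (no regularity of the boundary is needed), let $T>0$, $I=[0,T]$, $N\ge 1$, and let $-1<\alpha_{-1}<\alpha_0=0<\alpha_1<\dots<\alpha_N$ (so $\alpha_{-1}=-\alpha$ with $\alpha\in(0,1)$). Put $s=\alpha_N+2$, $s^*=s/(s-1)$ and, for $\mathbf a=(a_{-1},a_0,\dots,a_N)$ and $z\ge0$, $$F(\mathbf a,z)=a_{-1}z^{-\alpha}+a_0+a_1z^{\alpha_1}+\dots+a_Nz^{\alpha_N},$$ where $F(\mathbf a,|\mathbf m|)\mathbf m$ is understood to be $0$ when $\mathbf m=0$. Let $Q=L^2(\Omega)$ and $V=\{\mathbf v\in L^s(\Omega)^d:\nabla\cdot\mathbf v\in L^2(\Omega)\}$, with the divergence in the sense of distributions, and let $(\cdot,\cdot)$ denote $\int_\Omega$ of the product. Data: a measurable porosity $\phi$ with $0<\phi_*\le\phi\le\phi^*$ on $\Omega$, a source $f\in L^2(I,L^2(\Omega))$, an extension $\Psi$ of the boundary data with weak derivatives $\Psi_t\in L^2(I,L^2(\Omega))$ and $\nabla\Psi\in L^{s^*}(I,L^{s^*}(\Omega))$,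 and an initial value $\bar\rho_0\in L^2(\Omega)$. Coefficient vectors are measurable $\mathbf a:\Omega\times I\to\mathbb R^{N+2}$ with $0<a_*\le a_{-1},a_0,a_N\le a^*$ and $0\le a_i\le a^*$ for $1\le i\le N-1$, almost everywhere. A solution of the weak problem with coefficient vector $\mathbf a$ is a pair $(\mathbf m,\bar\rho)$ with $\mathbf m$ measurable on $\Omega\times I$, $\mathbf m(t)\in V$ for almost every $t$, $\bar\rho(t)=\bar\rho_0+\int_0^t\bar\rho_t\,d\tau$ in $L^2(\Omega)$ for all $t\in I$ with some $\bar\rho_t\in L^1(I,L^2(\Omega))$, such that for almost every $t\in I$ $$(F(\mathbf a,|\mathbf m|)\mathbf m,\mathbf v)-(\bar\rho,\nabla\cdot\mathbf v)=-(\nabla\Psi,\mathbf v)\quad\forall\,\mathbf v\in V,$$ $$(\phi\bar\rho_t,q)+(\nabla\cdot\mathbf m,q)=(f,q)-(\phi\Psi_t,q)\quad\forall\,q\in Q.$$ Theorem (continuous dependence on the coefficients). For every $K\ge 0$ there is a constant $C>0$, depending only on $d,\Omega,T,N$, the exponents $\alpha_i$, the bounds $a_*,a^*,\phi_*,\phi^*$,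 and $K$, such that the following holds for all data with $$\|\bar\rho_0\|^2_{L^2(\Omega)}+\|f\|^2_{L^2(I,L^2(\Omega))}+\|\Psi_t\|^2_{L^2(I,L^2(\Omega))}+\|\nabla\Psi\|^{s^*}_{L^{s^*}(I,L^{s^*}(\Omega))}\le K.$$ If $(\mathbf m^{(1)},\bar\rho^{(1)})$ and $(\mathbf m^{(2)},\bar\rho^{(2)})$ are solutions of the weak problem with these same data and with coefficient vectors $\mathbf a_1$ and $\mathbf a_2$, respectively, then $$\|\bar\rho^{(1)}-\bar\rho^{(2)}\|^2_{L^\infty(I,L^2(\Omega))}+\|\mathbf m^{(1)}-\mathbf m^{(2)}\|^s_{L^s(I,L^s(\Omega))}\le C\,\|\mathbf a_1-\mathbf a_2\|^{s^*}_{L^\infty(I,L^\infty(\Omega))},$$ where $|\mathbf a_1-\mathbf a_2|$ is the maximum of the absolute values of the components. -/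

import Mathlib

open MeasureTheory TopologicalSpace Set
open scoped ENNReal NNReal Distributions

noncomputable section

namespace MixedRegimeFlow

/-- Euclidean space `ℝᵈ`. -/
abbrev E (d : ℕ) : Type := EuclideanSpace ℝ (Fin d)

variable {d N : ℕ}

/-! ### Mixed Lebesgue norms and measurability on `I × Ω`, where `I = [0, T]`

Time-dependent functions are written `u : ℝ → E d → F`, with `u t` the function `u(·, t)`. -/

/-- Lebesgue measure on `Ω`. -/
abbrev spaceMeasure (Ω : Opens (E d)) : Measure (E d) := volume.restrict (Ω : Set (E d))

/-- Lebesgue measure on the time interval `I = [0, T]`. -/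
abbrev timeMeasure (T : ℝ) : Measure ℝ := volume.restrict (Icc 0 T)

/-- The norm `‖u‖_{Lᵖ(I, L^q(Ω))}`, with values in `[0, ∞]`. -/
def mixedNorm {F : Type*} [NormedAddCommGroup F] (T : ℝ) (Ω : Opens (E d)) (p q : ℝ≥0∞)
    (u : ℝ → E d → F) : ℝ≥0∞ :=
  eLpNorm (fun t => eLpNorm (u t) q (spaceMeasure Ω)) p (timeMeasure T)

/-- Lebesgue measurability in `(t, x)`, up to null sets. -/
def JointlyMeasurable {F : Type*} [TopologicalSpace F] (T : ℝ) (Ω : Opens (E d))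
    (u : ℝ → E d → F) : Prop :=
  AEStronglyMeasurable (Function.uncurry u) ((timeMeasure T).prod (spaceMeasure Ω))

/-! ### Weak derivatives -/

/-- `z = ∇ · v` in the sense of distributions on `Ω`. It is only used for
`v ∈ Lˢ(Ω)ᵈ` and `z ∈ L²(Ω)`. -/
def IsWeakDivergence (Ω : Opens (E d)) (v : E d → E d) (z : E d → ℝ) : Prop :=
  ∀ χ : 𝓓(Ω, ℝ), ∫ x in (Ω : Set (E d)), inner ℝ (v x) (gradient χ x)
    = -∫ x in (Ω : Set (E d)), z x * χ x

/-- The locally integrable field `g` is the weak gradient on `Ω` of the locally integrable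
function `u`. -/
def IsWeakGradient (Ω : Opens (E d)) (u : E d → ℝ) (g : E d → E d) : Prop :=
  LocallyIntegrableOn u (Ω : Set (E d)) ∧ LocallyIntegrableOn g (Ω : Set (E d)) ∧
    ∀ χ : 𝓓(Ω, ℝ), ∀ i : Fin d, ∫ x in (Ω : Set (E d)), u x * gradient χ x i
      = -∫ x in (Ω : Set (E d)), g x i * χ x

/-- `r ∈ L¹(I, L²(Ω))` is the time derivative of `u`: the function `t ↦ u(·, t) - u(·, 0)` is the
indefinite integral of `r`, so that `u` is absolutely continuous in time, modulo `u(·, 0)`,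
with values in `L²(Ω)`. -/
structure IsTimeDerivative (T : ℝ) (Ω : Opens (E d)) (u r : ℝ → E d → ℝ) : Prop where
  measurable : JointlyMeasurable T Ω r
  finite : mixedNorm T Ω 1 2 r < ∞
  eq_integral : ∀ t ∈ Icc 0 T, ∀ᵐ x ∂(spaceMeasure Ω), u t x = u 0 x + ∫ τ in (0 : ℝ)..t, r τ x

/-! ### The generalized polynomial `F(a, z)`

Powers and coefficients have indices `-1, 0, …, N` in mathematics and `0, 1, …, N + 1` here. -/

/-- The vector of powers `(α₋₁, α₀, …, α_N)`:  `-1 < α₋₁ < α₀ = 0 < α₁ < ⋯ < α_N`. -/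
structure IsExponentVector (α : Fin (N + 2) → ℝ) : Prop where
  strictMono : StrictMono α
  neg_one_lt : -1 < α 0
  zero : α 1 = 0

/-- `F(a, z) = ∑ aᵢ z^{αᵢ}`, for `z ≥ 0`. At `z = 0` the singular term has the value `0`; only
the product `F(a, |m|) m`, which vanishes at `m = 0`, is used. -/
def genPoly (α a : Fin (N + 2) → ℝ) (z : ℝ) : ℝ := ∑ i, a i * z ^ (α i)

/-- The exponent `s = α_N + 2`. -/
def sExp (α : Fin (N + 2) → ℝ) : ℝ := α (Fin.last (N + 1)) + 2

/-- The conjugate exponent `s* = s / (s - 1)`. -/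
def sStar (α : Fin (N + 2) → ℝ) : ℝ := sExp α / (sExp α - 1)

/-- Measurable coefficients on `I × Ω` with `0 ≤ aᵢ ≤ a^*` for all `i`, and `a_* ≤ aᵢ` for
`i = -1, 0, N`. -/
structure IsCoefficient (T : ℝ) (Ω : Opens (E d)) (aLow aUp : ℝ)
    (a : ℝ → E d → Fin (N + 2) → ℝ) : Prop where
  measurable : JointlyMeasurable T Ω a
  bounds : ∀ᵐ y ∂((timeMeasure T).prod (spaceMeasure Ω)),
    (∀ i, 0 ≤ a y.1 y.2 i ∧ a y.1 y.2 i ≤ aUp) ∧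
      aLow ≤ a y.1 y.2 0 ∧ aLow ≤ a y.1 y.2 1 ∧ aLow ≤ a y.1 y.2 (Fin.last (N + 1))

/-! ### The problem -/

/-- The data of the initial boundary value problem, apart from the coefficient vector. -/
structure ProblemData (d : ℕ) where
  /-- porosity -/
  φ : E d → ℝ
  /-- source term -/
  f : ℝ → E d → ℝ
  /-- extension of the boundary data to `I × Ω` -/
  Ψ : ℝ → E d → ℝ
  /-- time derivative of `Ψ` -/
  Ψt : ℝ → E d → ℝ
  /-- spatial gradient of `Ψ` -/
  gradΨ : ℝ → E d → E d
  /-- initial value of `ρ̄ = ρ - Ψ` -/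
  ρ₀ : E d → ℝ

/-- The quantity
`‖ρ̄₀‖²_{L²} + ‖f‖²_{L²(I,L²)} + ‖Ψ_t‖²_{L²(I,L²)} + ‖∇Ψ‖^{s*}_{L^{s*}(I,L^{s*})}`. -/
def ProblemData.size (D : ProblemData d) (T : ℝ) (Ω : Opens (E d)) (α : Fin (N + 2) → ℝ) : ℝ≥0∞ :=
  eLpNorm D.ρ₀ 2 (spaceMeasure Ω) ^ 2 + mixedNorm T Ω 2 2 D.f ^ 2 + mixedNorm T Ω 2 2 D.Ψt ^ 2
    + mixedNorm T Ω (ENNReal.ofReal (sStar α)) (ENNReal.ofReal (sStar α)) D.gradΨ ^ (sStar α)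

/-- Measurable data with `φ_* ≤ φ ≤ φ^*`, such that `Ψt` and `gradΨ` are the derivatives of `Ψ`. -/
structure ProblemData.IsAdmissible (D : ProblemData d) (T : ℝ) (Ω : Opens (E d))
    (φLow φUp : ℝ) : Prop where
  measurable_φ : AEStronglyMeasurable D.φ (spaceMeasure Ω)
  bounds_φ : ∀ᵐ x ∂(spaceMeasure Ω), φLow ≤ D.φ x ∧ D.φ x ≤ φUp
  measurable_f : JointlyMeasurable T Ω D.f
  timeDerivative_Ψ : IsTimeDerivative T Ω D.Ψ D.Ψt
  measurable_gradΨ : JointlyMeasurable T Ω D.gradΨ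
  gradient_Ψ : ∀ᵐ t ∂(timeMeasure T), IsWeakGradient Ω (D.Ψ t) (D.gradΨ t)
  measurable_ρ₀ : AEStronglyMeasurable D.ρ₀ (spaceMeasure Ω)

/-- Membership of `v` in `V = {v ∈ Lˢ(Ω)ᵈ : ∇ · v ∈ L²(Ω)}`, with `z = ∇ · v`. -/
structure MemV (Ω : Opens (E d)) (s : ℝ) (v : E d → E d) (z : E d → ℝ) : Prop where
  memLp : MemLp v (ENNReal.ofReal s) (spaceMeasure Ω)
  memLp_div : MemLp z 2 (spaceMeasure Ω)
  isWeakDivergence : IsWeakDivergence Ω v z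

/-- `(m, ρ̄)` solves the mixed weak problem with coefficient vector `a`:  `ρ̄` has a time
derivative `ρ̄_t`, the initial value is `ρ̄(·, 0) = ρ̄₀`, and for almost every `t ∈ I` one has
`m(t) ∈ V` and
`(F(a, |m|) m, v) - (ρ̄, ∇ · v) = -(∇Ψ, v)` for all `v ∈ V`,
`(φ ρ̄_t, q) + (∇ · m, q) = (f, q) - (φ Ψ_t, q)` for all `q ∈ L²(Ω)`. -/
structure IsWeakSolution (T : ℝ) (Ω : Opens (E d)) (α : Fin (N + 2) → ℝ) (D : ProblemData d)
    (a : ℝ → E d → Fin (N + 2) → ℝ) (m : ℝ → E d → E d) (ρ : ℝ → E d → ℝ) : Prop where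
  measurable_m : JointlyMeasurable T Ω m
  initial : ρ 0 =ᵐ[spaceMeasure Ω] D.ρ₀
  equations : ∃ ρt : ℝ → E d → ℝ, IsTimeDerivative T Ω ρ ρt ∧
    ∀ᵐ t ∂(timeMeasure T), ∃ w : E d → ℝ, MemV Ω (sExp α) (m t) w ∧
      (∀ (v : E d → E d) (z : E d → ℝ), MemV Ω (sExp α) v z →
        (∫ x in (Ω : Set (E d)), inner ℝ (genPoly α (a t x) ‖m t x‖ • m t x) (v x))
            - ∫ x in (Ω : Set (E d)), ρ t x * z x
          = -∫ x in (Ω : Set (E d)), inner ℝ (D.gradΨ t x) (v x)) ∧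
      (∀ q : E d → ℝ, MemLp q 2 (spaceMeasure Ω) →
        (∫ x in (Ω : Set (E d)), D.φ x * ρt t x * q x) + (∫ x in (Ω : Set (E d)), w x * q x)
          = (∫ x in (Ω : Set (E d)), D.f t x * q x)
            - ∫ x in (Ω : Set (E d)), D.φ x * D.Ψt t x * q x)

end MixedRegimeFlow

end

namespace MixedRegimeFlow

/-! The map `x ↦ F(a, |x|) x` is a nonnegative combination of the maps `x ↦ |x|^β x` with `β > -1`.
Each of these is monotone, and the one of highest degree, whose coefficient is at least `aLow`,
controls `|x - y|^s`. Splitting `F(a₁, |x|) x - F(a₂, |y|) y` as `(F(a₁, |x|) x - F(a₁, |y|) y) +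
F(a₁ - a₂, |y|) y`, the last term is at most a multiple of `δ (1 + |y|^(s-1))`. Young's inequality
absorbs half of the monotonicity and leaves an error `C δ^(s*) (1 + |y|^s)`; this is
`exists_perturbation_le`.

Subtract the two weak problems and test with `v = m₁ - m₂`, `q = ρ₁ - ρ₂`: the divergence terms
cancel and the common data drop out. Since `ρ₁ - ρ₂` vanishes at time `0`, integration in time
bounds both norms by `δ^(s*)` times `1 + ∫∫ |m₂|^s`, up to constants.

It remains to bound `∫∫ |m₂|^s` in terms of `K` (`exists_flux_bound`). This is the energy estimate
for a single solution, tested with `v = m`, `q = ρ`. The term in `‖ρ‖²` on the right gets so small a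
weight that its supremum over `I` is absorbed on the left, without Gronwall's lemma.

The analytic point is the identity `½ d/dt (φ u, u) = (φ u_t, u)` for `u_t` merely in `L¹(I, L²)`.
By Minkowski's inequality `∫ |u_t| dτ` lies in `L²(Ω)`. Hence for almost every `x` the primitive is
absolutely continuous in time, the identity holds for each such `x`, and Fubini integrates it over
`Ω`. -/

theorem rpow_mul_self {β z : ℝ} (hβ : -1 < β) (hz : 0 ≤ z) : z ^ β * z = z ^ (β + 1) := by
  rcases hz.eq_or_lt with rfl | hz
  · rw [mul_zero, Real.zero_rpow (by linarith)]
  · rw [Real.rpow_add_one hz.ne']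


/-! ### Monotonicity of power maps and Young's inequality -/

section Pointwise

variable {H : Type*} [NormedAddCommGroup H] [InnerProductSpace ℝ H]

/-- Monotonicity of `x ↦ |x|^β x` for `β > -1`. -/
theorem inner_rpow_smul_sub_nonneg {β : ℝ} (hβ : -1 < β) (x y : H) :
    0 ≤ inner ℝ (‖x‖ ^ β • x - ‖y‖ ^ β • y) (x - y) := by
  have hx := norm_nonneg x
  have hy := norm_nonneg y
  have hxy : inner ℝ x y ≤ ‖x‖ * ‖y‖ := real_inner_le_norm x y
  have h1 := rpow_mul_self hβ hx
  have h2 := rpow_mul_self hβ hy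
  -- By Cauchy–Schwarz this product is a lower bound of the inner product; it is nonnegative because
  -- `z ↦ z^(β+1)` is increasing.
  have h3 : 0 ≤ (‖x‖ ^ (β + 1) - ‖y‖ ^ (β + 1)) * (‖x‖ - ‖y‖) := by
    rcases le_total ‖x‖ ‖y‖ with h | h
    · have := Real.rpow_le_rpow hx h (by linarith : 0 ≤ β + 1)
      nlinarith
    · have := Real.rpow_le_rpow hy h (by linarith : 0 ≤ β + 1)
      nlinarith
  have h4 : inner ℝ (‖x‖ ^ β • x - ‖y‖ ^ β • y) (x - y)
      = ‖x‖ ^ β * ‖x‖ ^ 2 + ‖y‖ ^ β * ‖y‖ ^ 2 - (‖x‖ ^ β + ‖y‖ ^ β) * inner ℝ x y := by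
    simp only [inner_sub_left, inner_sub_right, real_inner_smul_left,
      real_inner_self_eq_norm_sq, real_inner_comm x y]
    ring
  rw [h4]
  have h5 : 0 ≤ ‖x‖ ^ β + ‖y‖ ^ β := by positivity
  have h6 := mul_le_mul_of_nonneg_left hxy h5
  rw [← h1, ← h2] at h3
  nlinarith

/-- Strong monotonicity of `x ↦ |x|^p x` for `p ≥ 0`. -/
theorem norm_sub_rpow_le_inner {p : ℝ} (hp : 0 ≤ p) (x y : H) :
    2⁻¹ * 2⁻¹ ^ p * ‖x - y‖ ^ (p + 2) ≤ inner ℝ (‖x‖ ^ p • x - ‖y‖ ^ p • y) (x - y) := by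
  have hx := norm_nonneg x
  have hy := norm_nonneg y
  have hd := norm_nonneg (x - y)
  -- Symmetrizing in `x` and `y` isolates `|x - y|²`; the remainder is nonnegative because both of
  -- its factors have the sign of `|x| - |y|`.
  have h4 : inner ℝ (‖x‖ ^ p • x - ‖y‖ ^ p • y) (x - y)
      = 2⁻¹ * (‖x‖ ^ p + ‖y‖ ^ p) * ‖x - y‖ ^ 2
        + 2⁻¹ * ((‖x‖ ^ p - ‖y‖ ^ p) * (‖x‖ ^ 2 - ‖y‖ ^ 2)) := by
    rw [@norm_sub_sq_real]
    simp only [inner_sub_left, inner_sub_right, real_inner_smul_left,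
      real_inner_self_eq_norm_sq, real_inner_comm x y]
    ring
  have h3 : 0 ≤ (‖x‖ ^ p - ‖y‖ ^ p) * (‖x‖ ^ 2 - ‖y‖ ^ 2) := by
    rcases le_total ‖x‖ ‖y‖ with h | h
    · have := Real.rpow_le_rpow hx h hp
      have := pow_le_pow_left₀ hx h 2
      nlinarith
    · have := Real.rpow_le_rpow hy h hp
      have := pow_le_pow_left₀ hy h 2
      nlinarith
  -- The larger of the two norms is at least `|x - y| / 2`.
  have h5 : 2⁻¹ ^ p * ‖x - y‖ ^ p ≤ ‖x‖ ^ p + ‖y‖ ^ p := by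
    rw [← Real.mul_rpow (by norm_num) hd]
    have hs : ‖x - y‖ ≤ ‖x‖ + ‖y‖ := norm_sub_le x y
    rcases le_total ‖x‖ ‖y‖ with h | h
    · calc (2⁻¹ * ‖x - y‖) ^ p ≤ ‖y‖ ^ p := Real.rpow_le_rpow (by positivity) (by linarith) hp
        _ ≤ _ := le_add_of_nonneg_left (by positivity)
    · calc (2⁻¹ * ‖x - y‖) ^ p ≤ ‖x‖ ^ p := Real.rpow_le_rpow (by positivity) (by linarith) hp
        _ ≤ _ := le_add_of_nonneg_right (by positivity)
  have h6 : ‖x - y‖ ^ (p + 2) = ‖x - y‖ ^ p * ‖x - y‖ ^ 2 := by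
    rcases hd.eq_or_lt with h | h
    · rw [← h, Real.zero_rpow (by linarith)]; simp
    · rw [Real.rpow_add h, Real.rpow_two]
  rw [h4, h6]
  have h7 := mul_le_mul_of_nonneg_right h5 (sq_nonneg ‖x - y‖)
  nlinarith

end Pointwise

/-- Young's inequality with a small weight on the first term. -/
theorem exists_young {p q : ℝ} (hpq : p.HolderConjugate q) {ε : ℝ} (hε : 0 < ε) :
    ∃ C : ℝ, 0 < C ∧ ∀ a b : ℝ, 0 ≤ a → 0 ≤ b → a * b ≤ ε * a ^ p + C * b ^ q := by
  -- Young's inequality for `(ε^(1/p) a) (ε^(-1/p) b)`, with the factors `1/p` and `1/q` discarded.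
  refine ⟨(ε ^ p⁻¹)⁻¹ ^ q, by positivity, fun a b ha hb => ?_⟩
  have hk : 0 < ε ^ p⁻¹ := by positivity
  have h := Real.young_inequality_of_nonneg (mul_nonneg hk.le ha)
    (mul_nonneg (inv_nonneg.2 hk.le) hb) hpq
  have h1 : ε ^ p⁻¹ * a * ((ε ^ p⁻¹)⁻¹ * b) = a * b := by field_simp
  rw [h1, Real.mul_rpow hk.le ha, Real.mul_rpow (inv_nonneg.2 hk.le) hb,
    Real.rpow_inv_rpow hε.le hpq.ne_zero] at h
  refine h.trans (add_le_add ?_ ?_)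
  · exact div_le_self (by positivity) hpq.lt.le
  · exact div_le_self (by positivity) hpq.symm.lt.le

/-! ### Growth, coercivity and perturbation of `F(a, |x|) x` -/

section GenPoly

variable {N : ℕ} {α : Fin (N + 2) → ℝ}

theorem IsExponentVector.neg_one_lt_apply (hα : IsExponentVector α) (i : Fin (N + 2)) :
    -1 < α i :=
  hα.neg_one_lt.trans_le (hα.strictMono.monotone (Fin.zero_le i))

theorem IsExponentVector.le_last (hα : IsExponentVector α) (i : Fin (N + 2)) :
    α i ≤ α (Fin.last (N + 1)) :=
  hα.strictMono.monotone (Fin.le_last i)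

theorem IsExponentVector.last_pos (hα : IsExponentVector α) (hN : 1 ≤ N) :
    0 < α (Fin.last (N + 1)) := by
  rw [← hα.zero]
  apply hα.strictMono
  rw [Fin.lt_def]
  simp
  omega

theorem IsExponentVector.two_lt_sExp (hα : IsExponentVector α) (hN : 1 ≤ N) : 2 < sExp α := by
  have := hα.last_pos hN
  unfold sExp
  linarith

theorem IsExponentVector.holderConjugate (hα : IsExponentVector α) (hN : 1 ≤ N) :
    (sExp α).HolderConjugate (sStar α) :=
  Real.HolderConjugate.conjExponent (by linarith [hα.two_lt_sExp hN])

/-- Since `0 < α i + 1 ≤ s - 1`, the constant dominates for `z ≤ 1` and the top power for `z ≥ 1`.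
The extra factor `z` compensates the singular power. -/
theorem IsExponentVector.rpow_mul_le (hα : IsExponentVector α) (i : Fin (N + 2)) {z : ℝ}
    (hz : 0 ≤ z) : z ^ α i * z ≤ 1 + z ^ (sExp α - 1) := by
  have h1 := hα.neg_one_lt_apply i
  have h2 := hα.le_last i
  rw [rpow_mul_self h1 hz]
  rcases le_total z 1 with h | h
  · have := Real.rpow_le_one hz h (by linarith : 0 ≤ α i + 1)
    have : 0 ≤ z ^ (sExp α - 1) := by positivity
    linarith
  · have := Real.rpow_le_rpow_of_exponent_le h (by unfold sExp; linarith : α i + 1 ≤ sExp α - 1)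
    linarith

/-- A bound of `|F(a, z)| z` in terms of a bound of the coefficients. -/
theorem IsExponentVector.abs_genPoly_mul_le (hα : IsExponentVector α) {a : Fin (N + 2) → ℝ}
    {B z : ℝ} (ha : ∀ i, |a i| ≤ B) (hz : 0 ≤ z) :
    |genPoly α a z| * z ≤ (N + 2) * B * (1 + z ^ (sExp α - 1)) := by
  have hB : 0 ≤ B := (abs_nonneg _).trans (ha 0)
  calc |genPoly α a z| * z ≤ (∑ i, |a i * z ^ α i|) * z := by
        unfold genPoly; gcongr; exact Finset.abs_sum_le_sum_abs _ _
    _ = ∑ i, |a i| * (z ^ α i * z) := by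
        rw [Finset.sum_mul]
        refine Finset.sum_congr rfl fun i _ => ?_
        rw [abs_mul, abs_of_nonneg (Real.rpow_nonneg hz _), mul_assoc]
    _ ≤ ∑ _i : Fin (N + 2), B * (1 + z ^ (sExp α - 1)) := by
        refine Finset.sum_le_sum fun i _ => mul_le_mul (ha i) (hα.rpow_mul_le i hz) ?_ hB
        positivity
    _ = _ := by simp; ring

theorem genPoly_sub (a b : Fin (N + 2) → ℝ) (z : ℝ) :
    genPoly α (a - b) z = genPoly α a z - genPoly α b z := by
  simp [genPoly, sub_mul]

variable {H : Type*} [NormedAddCommGroup H] [InnerProductSpace ℝ H]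

theorem IsExponentVector.norm_genPoly_smul_le (hα : IsExponentVector α) {a : Fin (N + 2) → ℝ}
    {B : ℝ} (ha : ∀ i, |a i| ≤ B) (x : H) :
    ‖genPoly α a ‖x‖ • x‖ ≤ (N + 2) * B * (1 + ‖x‖ ^ (sExp α - 1)) := by
  rw [norm_smul]
  exact hα.abs_genPoly_mul_le ha (norm_nonneg x)

theorem genPoly_smul (a : Fin (N + 2) → ℝ) (x : H) :
    genPoly α a ‖x‖ • x = ∑ i, a i • ‖x‖ ^ α i • x := by
  simp [genPoly, Finset.sum_smul, mul_smul]

/-- Strong monotonicity of `x ↦ F(a, |x|) x`. -/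
theorem IsExponentVector.norm_sub_rpow_le_inner_genPoly (hα : IsExponentVector α) (hN : 1 ≤ N)
    {a : Fin (N + 2) → ℝ} {b : ℝ} (ha : ∀ i, 0 ≤ a i) (hb : b ≤ a (Fin.last (N + 1))) (x y : H) :
    b * (2⁻¹ * 2⁻¹ ^ α (Fin.last (N + 1))) * ‖x - y‖ ^ sExp α
      ≤ inner ℝ (genPoly α a ‖x‖ • x - genPoly α a ‖y‖ • y) (x - y) := by
  have h1 : inner ℝ (genPoly α a ‖x‖ • x - genPoly α a ‖y‖ • y) (x - y)
      = ∑ i, a i * inner ℝ (‖x‖ ^ α i • x - ‖y‖ ^ α i • y) (x - y) := by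
    rw [genPoly_smul, genPoly_smul, ← Finset.sum_sub_distrib, sum_inner]
    refine Finset.sum_congr rfl fun i _ => ?_
    rw [← smul_sub, real_inner_smul_left]
  have h2 := norm_sub_rpow_le_inner (hα.last_pos hN).le x y
  rw [h1]
  calc _ ≤ a (Fin.last (N + 1)) * (2⁻¹ * 2⁻¹ ^ α (Fin.last (N + 1))) * ‖x - y‖ ^ sExp α := by
        gcongr
    _ ≤ a (Fin.last (N + 1)) * inner ℝ (‖x‖ ^ α (Fin.last (N + 1)) • x
          - ‖y‖ ^ α (Fin.last (N + 1)) • y) (x - y) := by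
        rw [mul_assoc]
        exact mul_le_mul_of_nonneg_left h2 (ha _)
    -- All terms except the one of highest degree are dropped, being nonnegative by monotonicity.
    _ ≤ _ := Finset.single_le_sum
        (f := fun i => a i * inner ℝ (‖x‖ ^ α i • x - ‖y‖ ^ α i • y) (x - y))
        (fun i _ => mul_nonneg (ha i) (inner_rpow_smul_sub_nonneg (hα.neg_one_lt_apply i) x y))
        (Finset.mem_univ _)

/-- Coercivity of `x ↦ F(a, |x|) x`. -/
theorem IsExponentVector.rpow_le_inner_genPoly (hα : IsExponentVector α) (hN : 1 ≤ N)
    {a : Fin (N + 2) → ℝ} {b : ℝ} (ha : ∀ i, 0 ≤ a i) (hb : b ≤ a (Fin.last (N + 1))) (x : H) :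
    b * ‖x‖ ^ sExp α ≤ inner ℝ (genPoly α a ‖x‖ • x) x := by
  have hp := hα.last_pos hN
  have h6 : ‖x‖ ^ sExp α = ‖x‖ ^ α (Fin.last (N + 1)) * ‖x‖ ^ 2 := by
    unfold sExp
    rcases (norm_nonneg x).eq_or_lt with h | h
    · rw [← h, Real.zero_rpow (by linarith)]; simp
    · rw [Real.rpow_add h, Real.rpow_two]
  rw [real_inner_smul_left, real_inner_self_eq_norm_sq, h6, ← mul_assoc]
  gcongr
  calc _ ≤ a (Fin.last (N + 1)) * ‖x‖ ^ α (Fin.last (N + 1)) := by gcongr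
    _ ≤ _ := Finset.single_le_sum (f := fun i => a i * ‖x‖ ^ α i)
        (fun i _ => mul_nonneg (ha i) (by positivity)) (Finset.mem_univ _)

/-- From `(s - 1) s* = s`: growth of order `s - 1` sends `Lˢ` to the dual `L^(s*)`. -/
theorem IsExponentVector.one_add_rpow_le (hα : IsExponentVector α) (hN : 1 ≤ N) {z : ℝ}
    (hz : 0 ≤ z) : (1 + z ^ (sExp α - 1)) ^ sStar α ≤ 2 ^ sStar α * (1 + z ^ sExp α) := by
  have hc := hα.holderConjugate hN
  have hs := hα.two_lt_sExp hN
  have hq := hc.symm.pos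
  have hm : (sExp α - 1) * sStar α = sExp α := by
    unfold sStar; field_simp [(by linarith : sExp α - 1 ≠ 0)]
  have hzs : 0 ≤ z ^ sExp α := by positivity
  rcases le_total z 1 with h | h
  · have h1 := Real.rpow_le_one hz h (by linarith : 0 ≤ sExp α - 1)
    calc (1 + z ^ (sExp α - 1)) ^ sStar α ≤ 2 ^ sStar α :=
          Real.rpow_le_rpow (by positivity) (by linarith) hq.le
      _ ≤ _ := le_mul_of_one_le_right (by positivity) (by linarith)
  · have h1 := Real.one_le_rpow h (by linarith : 0 ≤ sExp α - 1)
    calc (1 + z ^ (sExp α - 1)) ^ sStar α ≤ (2 * z ^ (sExp α - 1)) ^ sStar α :=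
          Real.rpow_le_rpow (by positivity) (by linarith) hq.le
      _ = 2 ^ sStar α * z ^ sExp α := by
          rw [Real.mul_rpow (by norm_num) (by positivity), ← Real.rpow_mul hz, hm]
      _ ≤ _ := by gcongr; linarith

/-- The perturbation estimate: strong monotonicity absorbs a change of the coefficients. -/
theorem IsExponentVector.exists_perturbation_le (hα : IsExponentVector α) (hN : 1 ≤ N)
    {b : ℝ} (hb : 0 < b) :
    ∃ c C : ℝ, 0 < c ∧ 0 < C ∧ ∀ (a₁ a₂ : Fin (N + 2) → ℝ) (δ : ℝ) (x y : H),
      (∀ i, 0 ≤ a₁ i) → b ≤ a₁ (Fin.last (N + 1)) → ‖a₁ - a₂‖ ≤ δ →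
      c * ‖x - y‖ ^ sExp α - C * δ ^ sStar α * (1 + ‖y‖ ^ sExp α)
        ≤ inner ℝ (genPoly α a₁ ‖x‖ • x - genPoly α a₂ ‖y‖ • y) (x - y) := by
  set c₀ : ℝ := b * (2⁻¹ * 2⁻¹ ^ α (Fin.last (N + 1))) with hc₀
  have hc₀pos : 0 < c₀ := by positivity
  -- The weight `c₀ / 2` leaves half of the strong monotonicity.
  obtain ⟨C, hC, hY⟩ := exists_young (hα.holderConjugate hN) (half_pos hc₀pos)
  refine ⟨c₀ / 2, C * ((N + 2) ^ sStar α * 2 ^ sStar α), half_pos hc₀pos, by positivity, ?_⟩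
  intro a₁ a₂ δ x y ha hb' hδ
  have hδ0 : 0 ≤ δ := (norm_nonneg _).trans hδ
  have h1 := hα.norm_sub_rpow_le_inner_genPoly hN ha hb' x y
  have h2 : inner ℝ (genPoly α a₁ ‖x‖ • x - genPoly α a₂ ‖y‖ • y) (x - y)
      = inner ℝ (genPoly α a₁ ‖x‖ • x - genPoly α a₁ ‖y‖ • y) (x - y)
        + inner ℝ (genPoly α (a₁ - a₂) ‖y‖ • y) (x - y) := by
    rw [← inner_add_left, genPoly_sub, sub_smul]
    congr 1
    abel
  rw [← hc₀] at h1
  have h3 : ‖genPoly α (a₁ - a₂) ‖y‖ • y‖ ≤ (N + 2) * δ * (1 + ‖y‖ ^ (sExp α - 1)) :=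
    hα.norm_genPoly_smul_le (fun i => (norm_le_pi_norm (a₁ - a₂) i).trans hδ) y
  have h4 := neg_le_of_abs_le (abs_real_inner_le_norm (genPoly α (a₁ - a₂) ‖y‖ • y) (x - y))
  have h5 := hY ‖x - y‖ ((N + 2) * δ * (1 + ‖y‖ ^ (sExp α - 1))) (norm_nonneg _) (by positivity)
  have h6 := mul_le_mul_of_nonneg_right h3 (norm_nonneg (x - y))
  have h7 : ((N + 2) * δ * (1 + ‖y‖ ^ (sExp α - 1))) ^ sStar α
      ≤ (N + 2) ^ sStar α * 2 ^ sStar α * δ ^ sStar α * (1 + ‖y‖ ^ sExp α) := by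
    rw [Real.mul_rpow (by positivity) (by positivity), Real.mul_rpow (by positivity) hδ0]
    have := mul_le_mul_of_nonneg_left (hα.one_add_rpow_le hN (norm_nonneg y))
      (by positivity : 0 ≤ (N + 2 : ℝ) ^ sStar α * δ ^ sStar α)
    linarith
  have h8 := mul_le_mul_of_nonneg_left h7 hC.le
  rw [h2]
  linarith

end GenPoly


/-! ### Primitives in time of functions in `L¹(I, L²)` -/

/-- Minkowski's integral inequality for the exponent `2`. -/
theorem lintegral_lintegral_sq_le {X Y : Type*} [MeasurableSpace X] [MeasurableSpace Y]
    (μ : Measure X) (ν : Measure Y) [SFinite μ] [SFinite ν] {k : Y → X → ℝ≥0∞}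
    (hk : Measurable (Function.uncurry k)) :
    ∫⁻ x, (∫⁻ τ, k τ x ∂ν) ^ (2 : ℝ) ∂μ
      ≤ (∫⁻ τ, (∫⁻ x, k τ x ^ (2 : ℝ) ∂μ) ^ (1 / 2 : ℝ) ∂ν) ^ (2 : ℝ) := by
  have hkx : ∀ τ, Measurable (k τ) := fun τ => hk.comp measurable_prodMk_left
  have hkτ : ∀ x, Measurable fun τ => k τ x := fun x => hk.comp measurable_prodMk_right
  have hN : Measurable fun τ => (∫⁻ x, k τ x ^ (2 : ℝ) ∂μ) ^ (1 / 2 : ℝ) :=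
    (Measurable.lintegral_prod_right' (f := fun p : Y × X => k p.1 p.2 ^ (2 : ℝ))
      (hk.pow_const _)).pow_const _
  -- Written as a double integral, the square can be exchanged with the integral over `X`;
  -- Cauchy–Schwarz in `x` then separates the two factors.
  have sq : ∀ {f : Y → ℝ≥0∞}, Measurable f →
      (∫⁻ τ, f τ ∂ν) ^ (2 : ℝ) = ∫⁻ p : Y × Y, f p.1 * f p.2 ∂(ν.prod ν) := by
    intro f hf
    rw [ENNReal.rpow_two, sq, lintegral_prod_mul hf.aemeasurable hf.aemeasurable]
  have hm : Measurable fun p : X × Y × Y => k p.2.1 p.1 * k p.2.2 p.1 :=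
    (hk.comp ((measurable_fst.comp measurable_snd).prodMk measurable_fst)).mul
      (hk.comp ((measurable_snd.comp measurable_snd).prodMk measurable_fst))
  calc ∫⁻ x, (∫⁻ τ, k τ x ∂ν) ^ (2 : ℝ) ∂μ
      = ∫⁻ x, ∫⁻ p : Y × Y, k p.1 x * k p.2 x ∂(ν.prod ν) ∂μ := by
        refine lintegral_congr fun x => sq (hkτ x)
    _ = ∫⁻ p : Y × Y, ∫⁻ x, k p.1 x * k p.2 x ∂μ ∂(ν.prod ν) :=
        lintegral_lintegral_swap hm.aemeasurable
    _ ≤ ∫⁻ p : Y × Y, (∫⁻ x, k p.1 x ^ (2 : ℝ) ∂μ) ^ (1 / 2 : ℝ)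
          * (∫⁻ x, k p.2 x ^ (2 : ℝ) ∂μ) ^ (1 / 2 : ℝ) ∂(ν.prod ν) :=
        lintegral_mono fun p => ENNReal.lintegral_mul_le_Lp_mul_Lq μ Real.HolderConjugate.two_two
          (hkx p.1).aemeasurable (hkx p.2).aemeasurable
    _ = _ := (sq hN).symm

/-- Integration by parts of the primitive against itself. As `g` is only integrable, the primitive
is absolutely continuous, with derivative `g` almost everywhere. -/
theorem sq_add_intervalIntegral {g : ℝ → ℝ} {t : ℝ} (hg : IntervalIntegrable g volume 0 t)
    (c : ℝ) :
    (c + ∫ σ in (0 : ℝ)..t, g σ) ^ 2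
      = c ^ 2 + 2 * ∫ τ in (0 : ℝ)..t, g τ * (c + ∫ σ in (0 : ℝ)..τ, g σ) := by
  have hac := hg.absolutelyContinuousOnInterval_intervalIntegral (c := 0) (by simp)
  have h1 := hac.integral_deriv_mul_eq_sub hac
  have h2 : ∫ x in (0 : ℝ)..t, (deriv (fun x => ∫ v in (0 : ℝ)..x, g v) x * ∫ v in (0 : ℝ)..x, g v)
        + (∫ v in (0 : ℝ)..x, g v) * deriv (fun x => ∫ v in (0 : ℝ)..x, g v) x
      = ∫ τ in (0 : ℝ)..t, 2 * (g τ * ∫ σ in (0 : ℝ)..τ, g σ) := by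
    apply intervalIntegral.integral_congr_ae
    filter_upwards [hg.ae_hasDerivAt_integral] with x hx hxt
    rw [(hx (uIoc_subset_uIcc hxt) 0 (by simp)).deriv]
    ring
  rw [h2, intervalIntegral.integral_const_mul] at h1
  have h3 : IntervalIntegrable (fun τ => g τ * ∫ σ in (0 : ℝ)..τ, g σ) volume 0 t :=
    hg.mul_continuousOn hac.continuousOn
  have h4 : ∫ τ in (0 : ℝ)..t, g τ * (c + ∫ σ in (0 : ℝ)..τ, g σ)
      = (∫ τ in (0 : ℝ)..t, g τ * c) + ∫ τ in (0 : ℝ)..t, g τ * ∫ σ in (0 : ℝ)..τ, g σ := by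
    rw [← intervalIntegral.integral_add (hg.mul_const c) h3]
    simp_rw [mul_add]
  rw [h4, intervalIntegral.integral_mul_const]
  simp only [intervalIntegral.integral_same, mul_zero, sub_zero] at h1
  linear_combination -h1

theorem enorm_primitive_le {X : Type*} {T : ℝ} {r : ℝ → X → ℝ} {t : ℝ} (ht : t ∈ Icc 0 T) (x : X) :
    ‖∫ σ in (0 : ℝ)..t, r σ x‖ₑ ≤ ∫⁻ σ, ‖r σ x‖ₑ ∂(timeMeasure T) := by
  rw [intervalIntegral.integral_of_le ht.1]
  refine (enorm_integral_le_lintegral_enorm _).trans ?_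
  exact lintegral_mono_set fun y hy => ⟨hy.1.le, hy.2.trans ht.2⟩

section Primitive

variable {X : Type*} [MeasurableSpace X] {μ : Measure X} [SFinite μ] {T : ℝ} {r : ℝ → X → ℝ}

/-- The moving limit of integration is turned into the indicator of a measurable set of pairs `(τ,
σ)`, one for each sign of `τ`, so that measurability of parameter integrals applies. -/
theorem stronglyMeasurable_primitive (hr : StronglyMeasurable (Function.uncurry r)) :
    StronglyMeasurable (Function.uncurry fun τ x => ∫ σ in (0 : ℝ)..τ, r σ x) := by
  have key : ∀ S : Set (ℝ × ℝ), MeasurableSet S →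
      StronglyMeasurable fun p : ℝ × X => ∫ σ, {σ | (p.1, σ) ∈ S}.indicator (fun σ => r σ p.2) σ := by
    intro S hS
    have hm : StronglyMeasurable fun q : (ℝ × X) × ℝ =>
        {q : (ℝ × X) × ℝ | (q.1.1, q.2) ∈ S}.indicator (fun q => r q.2 q.1.2) q :=
      (hr.comp_measurable (measurable_snd.prodMk (measurable_snd.comp measurable_fst))).indicator
        (((measurable_fst.comp measurable_fst).prodMk measurable_snd) hS)
    exact hm.integral_prod_right'
  have h1 := key {p | p.2 ∈ Ioc 0 p.1} ((measurableSet_lt measurable_const measurable_snd).inter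
    (measurableSet_le measurable_snd measurable_fst))
  have h2 := key {p | p.2 ∈ Ioc p.1 0} ((measurableSet_lt measurable_fst measurable_snd).inter
    (measurableSet_le measurable_snd measurable_const))
  convert h1.sub h2 using 1
  ext ⟨τ, x⟩
  simp only [Function.uncurry, intervalIntegral, Pi.sub_apply, mem_ofPred_eq]
  congr 1
  · exact (integral_indicator measurableSet_Ioc).symm
  · exact (integral_indicator measurableSet_Ioc).symm

variable (hr : StronglyMeasurable (Function.uncurry r))
  (hfin : ∫⁻ τ, (∫⁻ x, ‖r τ x‖ₑ ^ (2 : ℝ) ∂μ) ^ (1 / 2 : ℝ) ∂(timeMeasure T) < ∞)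

include hr in
theorem measurable_lintegral_time : Measurable fun x => ∫⁻ σ, ‖r σ x‖ₑ ∂(timeMeasure T) :=
  Measurable.lintegral_prod_left' (f := fun p : ℝ × X => ‖r p.1 p.2‖ₑ) hr.enorm

include hr hfin in
theorem lintegral_time_sq_lt_top :
    ∫⁻ x, (∫⁻ σ, ‖r σ x‖ₑ ∂(timeMeasure T)) ^ (2 : ℝ) ∂μ < ∞ :=
  (lintegral_lintegral_sq_le μ (timeMeasure T) (k := fun τ x => ‖r τ x‖ₑ) hr.enorm).trans_lt
    (ENNReal.rpow_lt_top_of_nonneg (by norm_num) hfin.ne)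

include hr hfin in
theorem ae_integrable_time : ∀ᵐ x ∂μ, Integrable (fun σ => r σ x) (timeMeasure T) := by
  have h1 := ae_lt_top' ((measurable_lintegral_time (T := T) hr).pow_const (2 : ℝ)).aemeasurable
    (lintegral_time_sq_lt_top hr hfin).ne
  filter_upwards [h1] with x hx
  refine ⟨(hr.comp_measurable measurable_prodMk_right).aestronglyMeasurable, ?_⟩
  by_contra h
  rw [HasFiniteIntegral, not_lt, top_le_iff] at h
  simp [h] at hx

include hr hfin in
theorem memLp_lintegral_time :
    MemLp (fun x => (∫⁻ σ, ‖r σ x‖ₑ ∂(timeMeasure T)).toReal) 2 μ := by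
  refine ⟨(measurable_lintegral_time hr).ennreal_toReal.aestronglyMeasurable, ?_⟩
  rw [eLpNorm_lt_top_iff_lintegral_rpow_enorm_lt_top (by norm_num) (by norm_num)]
  refine lt_of_le_of_lt (lintegral_mono fun x => ?_) (lintegral_time_sq_lt_top hr hfin)
  simp only [ENNReal.toReal_ofNat]
  gcongr
  rw [Real.enorm_eq_ofReal ENNReal.toReal_nonneg]
  exact ENNReal.ofReal_toReal_le

include hr hfin in
-- The majorant `|u₀| + ∫ |r| dσ` does not depend on `t`, hence neither does `S`. This makes the
-- supremum in time finite in the a priori estimate.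
theorem memLp_primitive {u₀ : X → ℝ} (hu : MemLp u₀ 2 μ) :
    ∃ S : ℝ, ∀ t ∈ Icc 0 T, MemLp (fun x => u₀ x + ∫ σ in (0 : ℝ)..t, r σ x) 2 μ ∧
      ∫ x, (u₀ x + ∫ σ in (0 : ℝ)..t, r σ x) ^ 2 ∂μ ≤ S := by
  have hG := memLp_lintegral_time hr hfin
  have hb := hu.norm.add hG
  have hbound : ∀ t ∈ Icc 0 T, ∀ᵐ x ∂μ, ‖u₀ x + ∫ σ in (0 : ℝ)..t, r σ x‖
      ≤ ‖u₀ x‖ + (∫⁻ σ, ‖r σ x‖ₑ ∂(timeMeasure T)).toReal := by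
    intro t ht
    filter_upwards [ae_integrable_time hr hfin] with x hx
    refine (norm_add_le _ _).trans (add_le_add le_rfl ?_)
    rw [← toReal_enorm]
    exact ENNReal.toReal_mono hx.2.ne (enorm_primitive_le ht x)
  refine ⟨∫ x, (‖u₀ x‖ + (∫⁻ σ, ‖r σ x‖ₑ ∂(timeMeasure T)).toReal) ^ 2 ∂μ, fun t ht => ?_⟩
  have hmem : MemLp (fun x => u₀ x + ∫ σ in (0 : ℝ)..t, r σ x) 2 μ := by
    refine hb.mono (hu.1.add ((stronglyMeasurable_primitive hr).comp_measurable
      measurable_prodMk_left).aestronglyMeasurable) ?_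
    filter_upwards [hbound t ht] with x hx
    exact hx.trans (Real.le_norm_self _)
  refine ⟨hmem, integral_mono_ae hmem.integrable_sq hb.integrable_sq ?_⟩
  filter_upwards [hbound t ht] with x hx
  rw [← sq_abs]
  exact pow_le_pow_left₀ (abs_nonneg _) hx 2

include hr hfin in
-- With `G = ∫ |r| dσ`, integrating in time first gives at most `B (|u₀| + G) G`, which is
-- integrable because `u₀` and `G` are in `L²`.
theorem integrable_energy_density {u₀ φ : X → ℝ} (hu : MemLp u₀ 2 μ)
    (hφ : AEStronglyMeasurable φ μ) {B : ℝ} (hB : ∀ᵐ x ∂μ, |φ x| ≤ B) :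
    Integrable (Function.uncurry fun τ x => φ x * r τ x * (u₀ x + ∫ σ in (0 : ℝ)..τ, r σ x))
      ((timeMeasure T).prod μ) := by
  have hm : AEStronglyMeasurable
      (Function.uncurry fun τ x => φ x * r τ x * (u₀ x + ∫ σ in (0 : ℝ)..τ, r σ x))
      ((timeMeasure T).prod μ) :=
    (hφ.comp_snd.mul hr.aestronglyMeasurable).mul
      (hu.1.comp_snd.add (stronglyMeasurable_primitive hr).aestronglyMeasurable)
  refine ⟨hm, ?_⟩
  rw [HasFiniteIntegral, lintegral_prod_symm _ hm.enorm]
  set G : X → ℝ≥0∞ := fun x => ∫⁻ σ, ‖r σ x‖ₑ ∂(timeMeasure T) with hG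
  have hu2 : ∫⁻ x, ‖u₀ x‖ₑ ^ (2 : ℝ) ∂μ < ∞ := by
    have := hu.2
    rwa [eLpNorm_lt_top_iff_lintegral_rpow_enorm_lt_top (by norm_num) (by norm_num)] at this
  have hG2 := lintegral_time_sq_lt_top hr hfin
  have hmul : ∀ a b : ℝ≥0∞, (a + b) * b ≤ a ^ (2 : ℝ) + 2 * b ^ (2 : ℝ) := by
    intro a b
    simp only [ENNReal.rpow_two]
    have hab : a * b ≤ a ^ 2 + b ^ 2 := by
      rcases le_total a b with h | h
      · calc a * b ≤ b * b := by gcongr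
          _ = b ^ 2 := (sq b).symm
          _ ≤ _ := le_add_self
      · calc a * b ≤ a * a := by gcongr
          _ = a ^ 2 := (sq a).symm
          _ ≤ _ := le_self_add
    calc (a + b) * b = a * b + b ^ 2 := by ring
      _ ≤ a ^ 2 + b ^ 2 + b ^ 2 := by gcongr
      _ = _ := by ring
  calc _ ≤ ∫⁻ x, ENNReal.ofReal B * (‖u₀ x‖ₑ ^ (2 : ℝ) + 2 * G x ^ (2 : ℝ)) ∂μ := by
        refine lintegral_mono_ae ?_
        filter_upwards [hB] with x hx
        calc ∫⁻ τ, ‖φ x * r τ x * (u₀ x + ∫ σ in (0 : ℝ)..τ, r σ x)‖ₑ ∂(timeMeasure T)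
            ≤ ∫⁻ τ, ENNReal.ofReal B * (‖u₀ x‖ₑ + G x) * ‖r τ x‖ₑ ∂(timeMeasure T) := by
              refine lintegral_mono_ae ?_
              filter_upwards [ae_restrict_mem measurableSet_Icc] with τ hτ
              rw [enorm_mul, enorm_mul]
              have h1 : ‖φ x‖ₑ ≤ ENNReal.ofReal B := by
                rw [← ofReal_norm]; exact ENNReal.ofReal_le_ofReal hx
              have h2 : ‖u₀ x + ∫ σ in (0 : ℝ)..τ, r σ x‖ₑ ≤ ‖u₀ x‖ₑ + G x :=
                (enorm_add_le _ _).trans (add_le_add le_rfl (enorm_primitive_le hτ x))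
              calc _ ≤ ENNReal.ofReal B * ‖r τ x‖ₑ * (‖u₀ x‖ₑ + G x) := by gcongr
                _ = _ := by ring
          _ = ENNReal.ofReal B * (‖u₀ x‖ₑ + G x) * G x :=
              lintegral_const_mul _ (hr.comp_measurable measurable_prodMk_right).enorm
          _ ≤ _ := by rw [mul_assoc]; gcongr; exact hmul _ _
    _ = ENNReal.ofReal B * (∫⁻ x, ‖u₀ x‖ₑ ^ (2 : ℝ) ∂μ + 2 * ∫⁻ x, G x ^ (2 : ℝ) ∂μ) := by
        rw [lintegral_const_mul' _ _ ENNReal.ofReal_ne_top,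
          lintegral_add_right _ (((measurable_lintegral_time hr).pow_const _).const_mul _),
          lintegral_const_mul _ ((measurable_lintegral_time hr).pow_const _)]
    _ < ∞ := ENNReal.mul_lt_top ENNReal.ofReal_lt_top
        (ENNReal.add_lt_top.2 ⟨hu2, ENNReal.mul_lt_top (by norm_num) hG2⟩)

include hr hfin in
theorem integral_primitive_sq {u₀ φ : X → ℝ} (hu : MemLp u₀ 2 μ)
    (hφ : AEStronglyMeasurable φ μ) {B : ℝ} (hB : ∀ᵐ x ∂μ, |φ x| ≤ B) {t : ℝ} (ht : t ∈ Icc 0 T) :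
    ∫ x, φ x * (u₀ x + ∫ σ in (0 : ℝ)..t, r σ x) ^ 2 ∂μ
      = ∫ x, φ x * u₀ x ^ 2 ∂μ + 2 * ∫ τ in (0 : ℝ)..t,
          ∫ x, φ x * r τ x * (u₀ x + ∫ σ in (0 : ℝ)..τ, r σ x) ∂μ := by
  have hint : Integrable
      (Function.uncurry fun τ x => φ x * r τ x * (u₀ x + ∫ σ in (0 : ℝ)..τ, r σ x))
      ((volume.restrict (uIoc 0 t)).prod μ) := by
    refine (integrable_energy_density hr hfin hu hφ hB).mono_measure
      (Measure.prod_mono (Measure.restrict_mono ?_ le_rfl) le_rfl)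
    rw [uIoc_of_le ht.1]
    exact fun y hy => ⟨hy.1.le, hy.2.trans ht.2⟩
  have h0 : Integrable (fun x => φ x * u₀ x ^ 2) μ :=
    hu.integrable_sq.bdd_mul hφ hB
  rw [intervalIntegral_integral_swap hint, ← integral_const_mul, ← integral_add h0]
  · refine integral_congr_ae ?_
    filter_upwards [ae_integrable_time hr hfin] with x hx
    have hi : IntervalIntegrable (fun σ => r σ x) volume 0 t := by
      rw [intervalIntegrable_iff_integrableOn_Ioc_of_le ht.1]
      exact IntegrableOn.mono_set (t := Icc 0 T) hx (fun y hy => ⟨hy.1.le, hy.2.trans ht.2⟩)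
    simp only [mul_assoc]
    rw [sq_add_intervalIntegral hi, intervalIntegral.integral_const_mul]
    ring
  · refine Integrable.const_mul ?_ 2
    have := hint.integral_prod_right
    simpa only [intervalIntegral.integral_of_le ht.1, uIoc_of_le ht.1, Function.uncurry] using this

end Primitive


variable {d N : ℕ}

/-! ### Mixed norms as iterated integrals -/

section Norms

variable {F : Type*} [NormedAddCommGroup F] {T : ℝ} {Ω : Opens (E d)}

theorem mixedNorm_eq_lintegral {p q : ℝ} (hp : 0 < p) (hq : 0 < q) (u : ℝ → E d → F) :
    mixedNorm T Ω (ENNReal.ofReal p) (ENNReal.ofReal q) u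
      = (∫⁻ t, (∫⁻ x, ‖u t x‖ₑ ^ q ∂(spaceMeasure Ω)) ^ (1 / q * p) ∂(timeMeasure T)) ^ (1 / p) := by
  have h : ∀ r : ℝ, 0 < r → ENNReal.ofReal r ≠ 0 := fun r hr => by simpa using hr
  unfold mixedNorm
  rw [eLpNorm_eq_lintegral_rpow_enorm_toReal (h p hp) ENNReal.ofReal_ne_top,
    ENNReal.toReal_ofReal hp.le]
  congr 1
  refine lintegral_congr fun t => ?_
  rw [eLpNorm_eq_lintegral_rpow_enorm_toReal (h q hq) ENNReal.ofReal_ne_top,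
    ENNReal.toReal_ofReal hq.le, enorm_eq_self, ← ENNReal.rpow_mul]

theorem mixedNorm_rpow {p : ℝ} (hp : 0 < p) (u : ℝ → E d → F) :
    mixedNorm T Ω (ENNReal.ofReal p) (ENNReal.ofReal p) u ^ p
      = ∫⁻ t, ∫⁻ x, ‖u t x‖ₑ ^ p ∂(spaceMeasure Ω) ∂(timeMeasure T) := by
  rw [mixedNorm_eq_lintegral hp hp, ← ENNReal.rpow_mul]
  simp [hp.ne']

/-- Functions of finite norm in `Lᵖ(I, Lᵖ(Ω))`. -/
theorem integrable_of_mixedNorm_rpow_le {p : ℝ} (hp : 0 < p) {u : ℝ → E d → F}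
    (hu : JointlyMeasurable T Ω u) {K : ℝ≥0}
    (h : mixedNorm T Ω (ENNReal.ofReal p) (ENNReal.ofReal p) u ^ p ≤ K) :
    (∀ᵐ t ∂(timeMeasure T), MemLp (u t) (ENNReal.ofReal p) (spaceMeasure Ω)) ∧
    Integrable (fun t => ∫ x, ‖u t x‖ ^ p ∂(spaceMeasure Ω)) (timeMeasure T) ∧
    ∫ t, ∫ x, ‖u t x‖ ^ p ∂(spaceMeasure Ω) ∂(timeMeasure T) ≤ K := by
  rw [mixedNorm_rpow hp] at h
  have hm : AEStronglyMeasurable (fun z : ℝ × E d => ‖u z.1 z.2‖ ^ p)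
      ((timeMeasure T).prod (spaceMeasure Ω)) :=
    (hu.norm.aemeasurable.pow_const p).aestronglyMeasurable
  have he : ∀ t x, ‖‖u t x‖ ^ p‖ₑ = ‖u t x‖ₑ ^ p := fun t x => by
    rw [Real.enorm_rpow_of_nonneg (norm_nonneg _) hp.le, enorm_norm]
  have hl : ∫⁻ z, ‖‖u z.1 z.2‖ ^ p‖ₑ ∂((timeMeasure T).prod (spaceMeasure Ω)) ≤ K := by
    rw [lintegral_prod _ hm.enorm]
    simpa only [he] using h
  have hint : Integrable (fun z : ℝ × E d => ‖u z.1 z.2‖ ^ p)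
      ((timeMeasure T).prod (spaceMeasure Ω)) := ⟨hm, hl.trans_lt ENNReal.coe_lt_top⟩
  refine ⟨?_, hint.integral_prod_left, ?_⟩
  · filter_upwards [hint.prod_right_ae, hu.prodMk_left] with t ht htm
    replace htm : AEStronglyMeasurable (u t) (spaceMeasure Ω) := htm
    rw [← integrable_norm_rpow_iff htm (by simpa using hp) ENNReal.ofReal_ne_top,
      ENNReal.toReal_ofReal hp.le]
    exact ht
  · rw [← integral_prod _ hint, integral_eq_lintegral_of_nonneg_ae
      (Filter.Eventually.of_forall fun z => by positivity) hm]
    refine ENNReal.toReal_le_of_le_ofReal K.2 ?_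
    rw [ENNReal.ofReal_coe_nnreal]
    simpa only [← Real.enorm_of_nonneg (Real.rpow_nonneg (norm_nonneg _) p)] using hl

/-- The norm of `Lᵖ(I, Lᵖ(Ω))` as an iterated Bochner integral. -/
theorem mixedNorm_rpow_eq_ofReal {p : ℝ} (hp : 0 < p) {u : ℝ → E d → F}
    (hu : ∀ᵐ t ∂(timeMeasure T), MemLp (u t) (ENNReal.ofReal p) (spaceMeasure Ω))
    (hi : Integrable (fun t => ∫ x, ‖u t x‖ ^ p ∂(spaceMeasure Ω)) (timeMeasure T)) :
    mixedNorm T Ω (ENNReal.ofReal p) (ENNReal.ofReal p) u ^ p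
      = ENNReal.ofReal (∫ t, ∫ x, ‖u t x‖ ^ p ∂(spaceMeasure Ω) ∂(timeMeasure T)) := by
  rw [mixedNorm_rpow hp, ofReal_integral_eq_lintegral_ofReal hi
    (Filter.Eventually.of_forall fun t => integral_nonneg fun x => by positivity)]
  refine lintegral_congr_ae ?_
  filter_upwards [hu] with t ht
  have h1 : Integrable (fun x => ‖u t x‖ ^ p) (spaceMeasure Ω) := by
    have := ht.integrable_norm_rpow (by simpa using hp) ENNReal.ofReal_ne_top
    rwa [ENNReal.toReal_ofReal hp.le] at this
  rw [ofReal_integral_eq_lintegral_ofReal h1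
    (Filter.Eventually.of_forall fun x => by positivity)]
  refine lintegral_congr fun x => ?_
  rw [← ENNReal.ofReal_rpow_of_nonneg (norm_nonneg _) hp.le, ofReal_norm]

theorem aestronglyMeasurable_integral_rpow {p : ℝ} {u : ℝ → E d → F}
    (hu : JointlyMeasurable T Ω u) :
    AEStronglyMeasurable (fun t => ∫ x, ‖u t x‖ ^ p ∂(spaceMeasure Ω)) (timeMeasure T) :=
  AEStronglyMeasurable.integral_prod_right'
    (f := fun z : ℝ × E d => ‖u z.1 z.2‖ ^ p)
    (hu.norm.aemeasurable.pow_const p).aestronglyMeasurable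

theorem mixedNorm_one_two (u : ℝ → E d → F) : mixedNorm T Ω 1 2 u
      = ∫⁻ t, (∫⁻ x, ‖u t x‖ₑ ^ (2 : ℝ) ∂(spaceMeasure Ω)) ^ (1 / 2 : ℝ) ∂(timeMeasure T) := by
  have := mixedNorm_eq_lintegral (T := T) (Ω := Ω) (p := 1) (q := 2) (by norm_num) (by norm_num) u
  simpa using this

end Norms

theorem uIoc_zero_subset {t T : ℝ} (ht : t ∈ Icc 0 T) : uIoc 0 t ⊆ Icc 0 T := by
  rw [uIoc_of_le ht.1]
  exact fun y hy => ⟨hy.1.le, hy.2.trans ht.2⟩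

/-! ### Energy identity for weak time derivatives -/

section TimeDerivative

variable {T : ℝ} {Ω : Opens (E d)} {u r : ℝ → E d → ℝ}

/-- A strongly measurable representative of the time derivative. -/
theorem IsTimeDerivative.exists_stronglyMeasurable (h : IsTimeDerivative T Ω u r) :
    ∃ r' : ℝ → E d → ℝ, StronglyMeasurable (Function.uncurry r') ∧
      (∀ᵐ t ∂(timeMeasure T), r t =ᵐ[spaceMeasure Ω] r' t) ∧
      (∫⁻ τ, (∫⁻ x, ‖r' τ x‖ₑ ^ (2 : ℝ) ∂(spaceMeasure Ω)) ^ (1 / 2 : ℝ) ∂(timeMeasure T) < ∞) ∧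
      (∀ᵐ x ∂(spaceMeasure Ω), (fun t => r t x) =ᵐ[timeMeasure T] fun t => r' t x) ∧
      ∀ t ∈ Icc 0 T, ∀ᵐ x ∂(spaceMeasure Ω), u t x = u 0 x + ∫ τ in (0 : ℝ)..t, r' τ x := by
  obtain ⟨hm, hf, hi⟩ := h
  have hae := hm.ae_eq_mk
  have h1 : ∀ᵐ t ∂(timeMeasure T), r t =ᵐ[spaceMeasure Ω] Function.curry (hm.mk _) t :=
    Measure.ae_ae_of_ae_prod hae
  have h2 : ∀ᵐ x ∂(spaceMeasure Ω), (fun t => r t x) =ᵐ[timeMeasure T]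
      fun t => Function.curry (hm.mk _) t x :=
    Measure.ae_ae_of_ae_prod
      (Measure.measurePreserving_swap.quasiMeasurePreserving.ae hae)
  refine ⟨Function.curry (hm.mk _), by simpa using hm.stronglyMeasurable_mk, h1, ?_, h2, ?_⟩
  · rw [mixedNorm_one_two] at hf
    refine lt_of_eq_of_lt (lintegral_congr_ae ?_) hf
    filter_upwards [h1] with t ht
    congr 1
    refine lintegral_congr_ae ?_
    filter_upwards [ht] with x hx
    rw [hx]
  · intro t ht
    filter_upwards [hi t ht, h2] with x hx hx2
    rw [hx]
    congr 1
    apply intervalIntegral.integral_congr_ae_restrict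
    exact ae_restrict_of_ae_restrict_of_subset (uIoc_zero_subset ht) hx2

theorem IsTimeDerivative.memLp (h : IsTimeDerivative T Ω u r) :
    ∀ᵐ t ∂(timeMeasure T), MemLp (r t) 2 (spaceMeasure Ω) := by
  obtain ⟨r', hr, h1, hf, -, -⟩ := h.exists_stronglyMeasurable
  have hmeas : Measurable fun τ => (∫⁻ x, ‖r' τ x‖ₑ ^ (2 : ℝ) ∂(spaceMeasure Ω)) ^ (1 / 2 : ℝ) :=
    (Measurable.lintegral_prod_right' (f := fun p : ℝ × E d => ‖r' p.1 p.2‖ₑ ^ (2 : ℝ))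
      (hr.enorm.pow_const _)).pow_const _
  filter_upwards [h1, ae_lt_top' hmeas.aemeasurable hf.ne] with t ht htf
  refine (memLp_congr_ae ht).2 ⟨(hr.comp_measurable measurable_prodMk_left).aestronglyMeasurable, ?_⟩
  rw [eLpNorm_lt_top_iff_lintegral_rpow_enorm_lt_top (by norm_num) (by norm_num)]
  simpa [ENNReal.rpow_lt_top_iff_of_pos] using htf

theorem IsTimeDerivative.sub {u' r' : ℝ → E d → ℝ} (h : IsTimeDerivative T Ω u r)
    (h' : IsTimeDerivative T Ω u' r') : IsTimeDerivative T Ω (u - u') (r - r') where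
  measurable := h.measurable.sub h'.measurable
  finite := by
    have hm : ∀ {v s : ℝ → E d → ℝ}, IsTimeDerivative T Ω v s →
        ∀ᵐ t ∂(timeMeasure T), AEStronglyMeasurable (s t) (spaceMeasure Ω) :=
      fun hs => hs.measurable.prodMk_left
    have ha : AEMeasurable (fun t => eLpNorm (r t) 2 (spaceMeasure Ω)) (timeMeasure T) := by
      have := (h.measurable.enorm.pow_const (2 : ℝ)).lintegral_prod_right'.pow_const (1 / 2 : ℝ)
      refine this.congr (Filter.Eventually.of_forall fun t => ?_)
      simp [eLpNorm_eq_lintegral_rpow_enorm_toReal]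
    have hf := h.finite
    have hf' := h'.finite
    unfold mixedNorm at hf hf' ⊢
    simp only [eLpNorm_one_eq_lintegral_enorm, enorm_eq_self] at hf hf' ⊢
    refine lt_of_le_of_lt ?_ (ENNReal.add_lt_top.2 ⟨hf, hf'⟩)
    rw [← lintegral_add_left' ha]
    refine lintegral_mono_ae ?_
    filter_upwards [hm h, hm h'] with t ht ht'
    exact eLpNorm_sub_le ht ht' (by norm_num)
  eq_integral t ht := by
    -- Splitting the integral of the difference requires both functions of time to be integrable,
    -- which `ae_integrable_time` gives for almost every `x`.
    obtain ⟨s, hs, -, hf, h2, h3⟩ := h.exists_stronglyMeasurable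
    obtain ⟨s', hs', -, hf', h2', h3'⟩ := h'.exists_stronglyMeasurable
    have hsub := uIoc_zero_subset ht
    filter_upwards [h3 t ht, h3' t ht, ae_integrable_time hs hf, ae_integrable_time hs' hf',
      h2, h2'] with x hx hx' hi hi' he he'
    have hii : IntervalIntegrable (fun σ => s σ x) volume 0 t :=
      intervalIntegrable_iff.2 (IntegrableOn.mono_set (t := Icc 0 T) hi hsub)
    have hii' : IntervalIntegrable (fun σ => s' σ x) volume 0 t :=
      intervalIntegrable_iff.2 (IntegrableOn.mono_set (t := Icc 0 T) hi' hsub)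
    have hcongr : ∫ τ in (0 : ℝ)..t, (r - r') τ x = ∫ τ in (0 : ℝ)..t, s τ x - s' τ x := by
      apply intervalIntegral.integral_congr_ae_restrict
      refine ae_restrict_of_ae_restrict_of_subset hsub ?_
      filter_upwards [he, he'] with τ hτ hτ'
      simp only [Pi.sub_apply]
      rw [hτ, hτ']
    rw [hcongr, intervalIntegral.integral_sub hii hii']
    simp only [Pi.sub_apply, hx, hx']
    ring

/-- The energy identity `½ d/dt (φ u, u) = (φ u_t, u)` in integrated form. -/
theorem IsTimeDerivative.energy (h : IsTimeDerivative T Ω u r)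
    (hu : MemLp (u 0) 2 (spaceMeasure Ω)) {φ : E d → ℝ}
    (hφ : AEStronglyMeasurable φ (spaceMeasure Ω)) {B : ℝ}
    (hB : ∀ᵐ x ∂(spaceMeasure Ω), |φ x| ≤ B) :
    (∃ S : ℝ, ∀ t ∈ Icc 0 T, MemLp (u t) 2 (spaceMeasure Ω) ∧
      ∫ x, u t x ^ 2 ∂(spaceMeasure Ω) ≤ S) ∧
    Integrable (fun τ => ∫ x, φ x * r τ x * u τ x ∂(spaceMeasure Ω)) (timeMeasure T) ∧
    ∀ t ∈ Icc 0 T, ∫ x, φ x * u t x ^ 2 ∂(spaceMeasure Ω)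
      = ∫ x, φ x * u 0 x ^ 2 ∂(spaceMeasure Ω)
        + 2 * ∫ τ in (0 : ℝ)..t, ∫ x, φ x * r τ x * u τ x ∂(spaceMeasure Ω) := by
  obtain ⟨r', hr, h1, hf, -, h3⟩ := h.exists_stronglyMeasurable
  have hd : ∀ᵐ τ ∂(timeMeasure T), ∫ x, φ x * r τ x * u τ x ∂(spaceMeasure Ω)
      = ∫ x, φ x * r' τ x * (u 0 x + ∫ σ in (0 : ℝ)..τ, r' σ x) ∂(spaceMeasure Ω) := by
    filter_upwards [h1, ae_restrict_mem measurableSet_Icc] with τ hτ hτI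
    refine integral_congr_ae ?_
    filter_upwards [hτ, h3 τ hτI] with x hx hx'
    rw [hx, hx']
  refine ⟨?_, ?_, fun t ht => ?_⟩
  · obtain ⟨S, hS⟩ := memLp_primitive hr hf hu
    refine ⟨S, fun t ht => ?_⟩
    have hc := h3 t ht
    refine ⟨(memLp_congr_ae hc).2 (hS t ht).1, le_of_eq_of_le (integral_congr_ae ?_) (hS t ht).2⟩
    filter_upwards [hc] with x hx
    rw [hx]
  · exact (integrable_energy_density hr hf hu hφ hB).integral_prod_left.congr
      (hd.mono fun τ hτ => hτ.symm)
  · have hc : ∫ x, φ x * u t x ^ 2 ∂(spaceMeasure Ω)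
        = ∫ x, φ x * (u 0 x + ∫ σ in (0 : ℝ)..t, r' σ x) ^ 2 ∂(spaceMeasure Ω) := by
      refine integral_congr_ae ?_
      filter_upwards [h3 t ht] with x hx
      rw [hx]
    rw [hc, integral_primitive_sq hr hf hu hφ hB ht]
    congr 2
    apply intervalIntegral.integral_congr_ae_restrict
    exact ae_restrict_of_ae_restrict_of_subset (uIoc_zero_subset ht)
      (hd.mono fun τ hτ => hτ.symm)

end TimeDerivative

/-- Integration in time of a differential inequality `h + c p ≤ g`. -/
theorem integral_le_of_add_le {T : ℝ} (hT : 0 ≤ T) {h p g : ℝ → ℝ} {c : ℝ} (hc : 0 < c)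
    (hh : Integrable h (timeMeasure T)) (hg : Integrable g (timeMeasure T))
    (hp : AEStronglyMeasurable p (timeMeasure T)) (hp0 : ∀ t, 0 ≤ p t) (hg0 : ∀ t, 0 ≤ g t)
    (hle : ∀ᵐ t ∂(timeMeasure T), h t + c * p t ≤ g t) :
    Integrable p (timeMeasure T) ∧
    (∀ t ∈ Icc 0 T, ∫ τ in (0 : ℝ)..t, h τ ≤ ∫ τ, g τ ∂(timeMeasure T)) ∧
    (∫ τ in (0 : ℝ)..T, h τ) + c * ∫ τ, p τ ∂(timeMeasure T) ≤ ∫ τ, g τ ∂(timeMeasure T) := by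
  -- Integrability of `p` is a conclusion, from `0 ≤ p ≤ c⁻¹ (g - h)`. A weak solution carries no
  -- assumption on the integrability of the flux in time.
  have hpi : Integrable p (timeMeasure T) := by
    refine ((hg.sub hh).const_mul c⁻¹).mono' hp ?_
    filter_upwards [hle] with t ht
    rw [Real.norm_of_nonneg (hp0 t), Pi.sub_apply, le_inv_mul_iff₀ hc]
    linarith
  refine ⟨hpi, fun t ht => ?_, ?_⟩
  · have hsub : Ioc 0 t ⊆ Icc 0 T := fun y hy => ⟨hy.1.le, hy.2.trans ht.2⟩
    rw [intervalIntegral.integral_of_le ht.1]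
    calc ∫ τ in Ioc 0 t, h τ ≤ ∫ τ in Ioc 0 t, g τ := by
          refine integral_mono_ae (IntegrableOn.mono_set hh hsub) (IntegrableOn.mono_set hg hsub) ?_
          refine ae_restrict_of_ae_restrict_of_subset hsub ?_
          filter_upwards [hle] with τ hτ
          have := mul_nonneg hc.le (hp0 τ)
          linarith
      _ ≤ _ := setIntegral_mono_set hg (Filter.Eventually.of_forall hg0)
          (Filter.Eventually.of_forall hsub)
  · rw [intervalIntegral.integral_of_le hT, ← integral_Icc_eq_integral_Ioc, ← integral_const_mul,
      ← integral_add hh (hpi.const_mul c)]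
    exact integral_mono_ae (hh.add (hpi.const_mul c)) hg hle


/-! ### Integrability at a fixed time and the space `V` -/

section Slices

variable {Ω : Opens (E d)} {α : Fin (N + 2) → ℝ}

theorem eLpNorm_two_sq {X : Type*} [MeasurableSpace X] {μ : Measure X} {u : X → ℝ}
    (hu : MemLp u 2 μ) : eLpNorm u 2 μ ^ 2 = ENNReal.ofReal (∫ x, u x ^ 2 ∂μ) := by
  rw [ofReal_integral_eq_lintegral_ofReal hu.integrable_sq
    (Filter.Eventually.of_forall fun x => sq_nonneg _),
    eLpNorm_eq_lintegral_rpow_enorm_toReal (by norm_num) (by norm_num), ← ENNReal.rpow_two,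
    ← ENNReal.rpow_mul]
  simp only [ENNReal.toReal_ofNat, one_div, isUnit_iff_ne_zero, ne_eq, OfNat.ofNat_ne_zero,
    not_false_eq_true, IsUnit.inv_mul_cancel, ENNReal.rpow_one]
  refine lintegral_congr fun x => ?_
  rw [← sq_abs, ENNReal.ofReal_pow (abs_nonneg _), ENNReal.rpow_two, ← Real.norm_eq_abs,
    ofReal_norm]

theorem integrable_rpow_norm {X F : Type*} [MeasurableSpace X] {μ : Measure X}
    [NormedAddCommGroup F] {p : ℝ} (hp : 0 < p) {v : X → F} (hv : MemLp v (ENNReal.ofReal p) μ) :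
    Integrable (fun x => ‖v x‖ ^ p) μ := by
  have := hv.integrable_norm_rpow (by simpa using hp) ENNReal.ofReal_ne_top
  rwa [ENNReal.toReal_ofReal hp.le] at this

theorem integrable_inner_of_conjugate {X H : Type*} [MeasurableSpace X] {μ : Measure X}
    [NormedAddCommGroup H] [InnerProductSpace ℝ H] {p q : ℝ} (hpq : p.HolderConjugate q)
    {g v : X → H} (hg : MemLp g (ENNReal.ofReal q) μ) (hv : MemLp v (ENNReal.ofReal p) μ) :
    Integrable (fun x => inner ℝ (g x) (v x)) μ := by
  obtain ⟨C, -, hY⟩ := exists_young hpq one_pos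
  refine Integrable.mono' (((integrable_rpow_norm hpq.pos hv).const_mul 1).add
    ((integrable_rpow_norm hpq.symm.pos hg).const_mul C)) (hg.1.inner hv.1)
    (Filter.Eventually.of_forall fun x => ?_)
  refine (norm_inner_le_norm _ _).trans ?_
  rw [mul_comm]
  exact hY _ _ (norm_nonneg _) (norm_nonneg _)

theorem MemV.integrable_inner_gradient [IsFiniteMeasure (spaceMeasure Ω)] {s : ℝ} (hs : 1 ≤ s)
    {v : E d → E d} (hv : MemLp v (ENNReal.ofReal s) (spaceMeasure Ω)) (χ : 𝓓(Ω, ℝ)) :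
    Integrable (fun x => inner ℝ (v x) (gradient χ x)) (spaceMeasure Ω) := by
  have hv1 : Integrable v (spaceMeasure Ω) :=
    hv.integrable (by simpa using ENNReal.ofReal_le_ofReal hs)
  have hc : Continuous (fderiv ℝ χ) := χ.contDiff.continuous_fderiv (by simp)
  have hg : Continuous (gradient χ) := (InnerProductSpace.toDual ℝ (E d)).symm.continuous.comp hc
  obtain ⟨C, hC⟩ := χ.hasCompactSupport.fderiv (𝕜 := ℝ) |>.exists_bound_of_continuous hc
  refine Integrable.mono' (hv1.norm.mul_const C) (hv1.1.inner hg.aestronglyMeasurable)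
    (Filter.Eventually.of_forall fun x => ?_)
  refine (norm_inner_le_norm _ _).trans ?_
  gcongr
  have : ‖gradient χ x‖ = ‖fderiv ℝ χ x‖ := by simp [gradient]
  rw [this]
  exact hC x

/-- Makes `m₁ - m₂` an admissible test field. On a set of finite measure `Lˢ` and `L²` lie in `L¹`,
so all pairings with test functions converge and are linear. -/
theorem MemV.sub [IsFiniteMeasure (spaceMeasure Ω)] {s : ℝ} (hs : 1 ≤ s) {v v' : E d → E d}
    {z z' : E d → ℝ} (h : MemV Ω s v z) (h' : MemV Ω s v' z') : MemV Ω s (v - v') (z - z') where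
  memLp := h.memLp.sub h'.memLp
  memLp_div := h.memLp_div.sub h'.memLp_div
  isWeakDivergence χ := by
    obtain ⟨C, hC⟩ := χ.hasCompactSupport.exists_bound_of_continuous χ.contDiff.continuous
    have hz : ∀ {y : E d → ℝ}, MemLp y 2 (spaceMeasure Ω) →
        Integrable (fun x => y x * χ x) (spaceMeasure Ω) := fun hy =>
      (hy.integrable (by norm_num)).mul_bdd χ.contDiff.continuous.aestronglyMeasurable
        (Filter.Eventually.of_forall hC)
    simp only [Pi.sub_apply, inner_sub_left, sub_mul]
    rw [integral_sub (MemV.integrable_inner_gradient hs h.memLp χ)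
      (MemV.integrable_inner_gradient hs h'.memLp χ),
      integral_sub (hz h.memLp_div) (hz h'.memLp_div), h.isWeakDivergence χ, h'.isWeakDivergence χ]
    ring

variable [IsFiniteMeasure (spaceMeasure Ω)]

theorem IsExponentVector.integrable_inner_genPoly (hα : IsExponentVector α) (hN : 1 ≤ N)
    {a : E d → Fin (N + 2) → ℝ} (ha : AEStronglyMeasurable a (spaceMeasure Ω)) {B : ℝ}
    (hB : ∀ᵐ x ∂(spaceMeasure Ω), ∀ i, 0 ≤ a x i ∧ a x i ≤ B) {m v : E d → E d}
    (hm : MemLp m (ENNReal.ofReal (sExp α)) (spaceMeasure Ω))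
    (hv : MemLp v (ENNReal.ofReal (sExp α)) (spaceMeasure Ω)) :
    Integrable (fun x => inner ℝ (genPoly α (a x) ‖m x‖ • m x) (v x)) (spaceMeasure Ω) := by
  have hc := hα.holderConjugate hN
  obtain ⟨C, hC, hY⟩ := exists_young hc one_pos
  have hmeas : AEMeasurable (fun x => genPoly α (a x) ‖m x‖) (spaceMeasure Ω) := by
    unfold genPoly
    refine Finset.aemeasurable_fun_sum _ fun i _ => AEMeasurable.mul ?_
      (hm.1.norm.aemeasurable.pow_const _)
    exact (measurable_pi_apply i).comp_aemeasurable ha.aemeasurable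
  refine Integrable.mono' (((integrable_rpow_norm hc.pos hv).const_mul 1).add
    (((integrable_const 1).add (integrable_rpow_norm hc.pos hm)).const_mul
      (C * (((N + 2) * B) ^ sStar α * 2 ^ sStar α))))
    ((hmeas.aestronglyMeasurable.smul hm.1).inner hv.1) ?_
  filter_upwards [hB] with x hx
  have hB0 : 0 ≤ B := (hx 0).1.trans (hx 0).2
  have h1 := hα.norm_genPoly_smul_le (fun i => (abs_of_nonneg (hx i).1).trans_le (hx i).2) (m x)
  have h2 := hY ‖v x‖ ((N + 2) * B * (1 + ‖m x‖ ^ (sExp α - 1))) (norm_nonneg _) (by positivity)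
  rw [Real.mul_rpow (by positivity) (by positivity)] at h2
  have h3 := mul_le_mul_of_nonneg_left (hα.one_add_rpow_le hN (norm_nonneg (m x)))
      (by positivity : 0 ≤ C * (((N + 2 : ℝ) * B) ^ sStar α))
  have h4 := mul_le_mul_of_nonneg_right h1 (norm_nonneg (v x))
  have h5 := norm_inner_le_norm (𝕜 := ℝ) (genPoly α (a x) ‖m x‖ • m x) (v x)
  simp only [Pi.add_apply]
  linarith

end Slices


/-! ### Estimates at a fixed time -/

/-- The weak problem at a fixed time, with `f`, `ψ`, `g` the values of the source, of `Ψ_t` and of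
`∇Ψ`, with flux `m`, `w = ∇ · m`, density `ρ` and its time derivative `r`. -/
structure IsSliceSolution (Ω : Opens (E d)) (α : Fin (N + 2) → ℝ) (aLow aUp : ℝ)
    (φ f ψ : E d → ℝ) (g : E d → E d) (a : E d → Fin (N + 2) → ℝ) (m : E d → E d)
    (w ρ r : E d → ℝ) : Prop where
  measurable_a : AEStronglyMeasurable a (spaceMeasure Ω)
  bounds : ∀ᵐ x ∂(spaceMeasure Ω), ∀ i, 0 ≤ a x i ∧ a x i ≤ aUp
  lower_bound : ∀ᵐ x ∂(spaceMeasure Ω), aLow ≤ a x (Fin.last (N + 1))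
  memV : MemV Ω (sExp α) m w
  memLp_ρ : MemLp ρ 2 (spaceMeasure Ω)
  memLp_r : MemLp r 2 (spaceMeasure Ω)
  momentum : ∀ (v : E d → E d) (z : E d → ℝ), MemV Ω (sExp α) v z →
    (∫ x, inner ℝ (genPoly α (a x) ‖m x‖ • m x) (v x) ∂(spaceMeasure Ω))
      - ∫ x, ρ x * z x ∂(spaceMeasure Ω) = -∫ x, inner ℝ (g x) (v x) ∂(spaceMeasure Ω)
  mass : ∀ q : E d → ℝ, MemLp q 2 (spaceMeasure Ω) →
    (∫ x, φ x * r x * q x ∂(spaceMeasure Ω)) + (∫ x, w x * q x ∂(spaceMeasure Ω))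
      = (∫ x, f x * q x ∂(spaceMeasure Ω)) - ∫ x, φ x * ψ x * q x ∂(spaceMeasure Ω)

theorem integrable_weight_mul {X : Type*} [MeasurableSpace X] {μ : Measure X} {φ u v : X → ℝ} (hφ : AEStronglyMeasurable φ μ)
    {B : ℝ} (hB : ∀ᵐ x ∂μ, |φ x| ≤ B) (hu : MemLp u 2 μ)
    (hv : MemLp v 2 μ) :
    Integrable (fun x => φ x * u x * v x) μ := by
  simp only [mul_assoc]
  exact (hu.integrable_mul hv).bdd_mul hφ hB

section SliceEstimates

variable {Ω : Opens (E d)} [IsFiniteMeasure (spaceMeasure Ω)] {α : Fin (N + 2) → ℝ}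
  {aLow aUp : ℝ} {φ f ψ : E d → ℝ} {g : E d → E d}

/-- The energy estimate at a fixed time. -/
theorem IsSliceSolution.energy_le (hα : IsExponentVector α) (hN : 1 ≤ N)
    {a : E d → Fin (N + 2) → ℝ} {m : E d → E d} {w ρ r : E d → ℝ}
    (h : IsSliceSolution Ω α aLow aUp φ f ψ g a m w ρ r)
    (hφ : AEStronglyMeasurable φ (spaceMeasure Ω)) {B : ℝ}
    (hB : ∀ᵐ x ∂(spaceMeasure Ω), |φ x| ≤ B)
    (hf : MemLp f 2 (spaceMeasure Ω)) (hψ : MemLp ψ 2 (spaceMeasure Ω))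
    (hg : MemLp g (ENNReal.ofReal (sStar α)) (spaceMeasure Ω)) {C η : ℝ} (hη : 0 < η)
    (hC : ∀ x y : ℝ, 0 ≤ x → 0 ≤ y → x * y ≤ aLow / 2 * x ^ sExp α + C * y ^ sStar α) :
    (∫ x, φ x * r x * ρ x ∂(spaceMeasure Ω))
        + aLow / 2 * ∫ x, ‖m x‖ ^ sExp α ∂(spaceMeasure Ω)
      ≤ C * (∫ x, ‖g x‖ ^ sStar α ∂(spaceMeasure Ω))
        + (2 * η)⁻¹ * ((∫ x, f x ^ 2 ∂(spaceMeasure Ω)) + B ^ 2 * ∫ x, ψ x ^ 2 ∂(spaceMeasure Ω))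
        + η * ∫ x, ρ x ^ 2 ∂(spaceMeasure Ω) := by
  have hc := hα.holderConjugate hN
  have hmp := integrable_rpow_norm hc.pos h.memV.memLp
  have hgq := integrable_rpow_norm hc.symm.pos hg
  have hF := hα.integrable_inner_genPoly hN h.measurable_a h.bounds h.memV.memLp h.memV.memLp
  have hgm := integrable_inner_of_conjugate hc hg h.memV.memLp
  have hfρ : Integrable (fun x => f x * ρ x) (spaceMeasure Ω) := hf.integrable_mul h.memLp_ρ
  have hψρ := integrable_weight_mul hφ hB hψ h.memLp_ρ
  -- Testing with `v = m` and `q = ρ`: in the sum of the two equations the terms `(ρ, ∇ · m)`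
  -- cancel.
  have e1 := h.momentum m w h.memV
  have e2 := h.mass ρ h.memLp_ρ
  have e3 : ∫ x, w x * ρ x ∂(spaceMeasure Ω) = ∫ x, ρ x * w x ∂(spaceMeasure Ω) := by
    simp only [mul_comm]
  have hy : ∀ x y : ℝ, x * y ≤ η / 2 * y ^ 2 + (2 * η)⁻¹ * x ^ 2 := by
    intro x y
    have : η / 2 * y ^ 2 + (2 * η)⁻¹ * x ^ 2 - x * y = (2 * η)⁻¹ * (x - η * y) ^ 2 := by
      field_simp; ring
    have : 0 ≤ (2 * η)⁻¹ * (x - η * y) ^ 2 := by positivity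
    linarith
  have i1 : aLow * (∫ x, ‖m x‖ ^ sExp α ∂(spaceMeasure Ω))
      ≤ ∫ x, inner ℝ (genPoly α (a x) ‖m x‖ • m x) (m x) ∂(spaceMeasure Ω) := by
    rw [← integral_const_mul]
    refine integral_mono_ae (hmp.const_mul _) hF ?_
    filter_upwards [h.bounds, h.lower_bound] with x hx hx'
    exact hα.rpow_le_inner_genPoly hN (fun i => (hx i).1) hx' (m x)
  have i2 : -(∫ x, inner ℝ (g x) (m x) ∂(spaceMeasure Ω))
      ≤ aLow / 2 * (∫ x, ‖m x‖ ^ sExp α ∂(spaceMeasure Ω))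
        + C * ∫ x, ‖g x‖ ^ sStar α ∂(spaceMeasure Ω) := by
    rw [← integral_neg, ← integral_const_mul, ← integral_const_mul,
      ← integral_add (hmp.const_mul _) (hgq.const_mul _)]
    refine integral_mono hgm.neg ((hmp.const_mul _).add (hgq.const_mul _)) fun x => ?_
    have h1 := neg_le_of_abs_le (abs_real_inner_le_norm (g x) (m x))
    have h2 := hC ‖m x‖ ‖g x‖ (norm_nonneg _) (norm_nonneg _)
    linarith
  have i3 : ∫ x, f x * ρ x ∂(spaceMeasure Ω) ≤ η / 2 * (∫ x, ρ x ^ 2 ∂(spaceMeasure Ω))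
      + (2 * η)⁻¹ * ∫ x, f x ^ 2 ∂(spaceMeasure Ω) := by
    rw [← integral_const_mul, ← integral_const_mul,
      ← integral_add (h.memLp_ρ.integrable_sq.const_mul _) (hf.integrable_sq.const_mul _)]
    exact integral_mono hfρ ((h.memLp_ρ.integrable_sq.const_mul _).add
      (hf.integrable_sq.const_mul _)) fun x => hy _ _
  have i4 : -(∫ x, φ x * ψ x * ρ x ∂(spaceMeasure Ω))
      ≤ η / 2 * (∫ x, ρ x ^ 2 ∂(spaceMeasure Ω))
        + (2 * η)⁻¹ * B ^ 2 * ∫ x, ψ x ^ 2 ∂(spaceMeasure Ω) := by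
    rw [← integral_neg, ← integral_const_mul, ← integral_const_mul,
      ← integral_add (h.memLp_ρ.integrable_sq.const_mul _) (hψ.integrable_sq.const_mul _)]
    refine integral_mono_ae hψρ.neg ((h.memLp_ρ.integrable_sq.const_mul _).add
      (hψ.integrable_sq.const_mul _)) ?_
    filter_upwards [hB] with x hx
    have h1 := hy (-(φ x * ψ x)) (ρ x)
    have h2 : φ x ^ 2 ≤ B ^ 2 := sq_le_sq' (neg_le_of_abs_le hx) (le_of_abs_le hx)
    have h3 := mul_le_mul_of_nonneg_left h2 (by positivity : 0 ≤ (2 * η)⁻¹ * ψ x ^ 2)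
    nlinarith
  linarith

/-- The estimate at a fixed time for the difference of two solutions. -/
theorem IsSliceSolution.difference_le (hα : IsExponentVector α) (hN : 1 ≤ N)
    {a₁ a₂ : E d → Fin (N + 2) → ℝ} {m₁ m₂ : E d → E d} {w₁ w₂ ρ₁ ρ₂ r₁ r₂ : E d → ℝ}
    (h₁ : IsSliceSolution Ω α aLow aUp φ f ψ g a₁ m₁ w₁ ρ₁ r₁)
    (h₂ : IsSliceSolution Ω α aLow aUp φ f ψ g a₂ m₂ w₂ ρ₂ r₂)
    (hφ : AEStronglyMeasurable φ (spaceMeasure Ω)) {B : ℝ}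
    (hB : ∀ᵐ x ∂(spaceMeasure Ω), |φ x| ≤ B) {c C δ : ℝ}
    (hδ : ∀ᵐ x ∂(spaceMeasure Ω), ‖a₁ x - a₂ x‖ ≤ δ)
    (hc : ∀ (b₁ b₂ : Fin (N + 2) → ℝ) (δ : ℝ) (x y : E d),
      (∀ i, 0 ≤ b₁ i) → aLow ≤ b₁ (Fin.last (N + 1)) → ‖b₁ - b₂‖ ≤ δ →
      c * ‖x - y‖ ^ sExp α - C * δ ^ sStar α * (1 + ‖y‖ ^ sExp α)
        ≤ inner ℝ (genPoly α b₁ ‖x‖ • x - genPoly α b₂ ‖y‖ • y) (x - y)) :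
    (∫ x, φ x * (r₁ - r₂) x * (ρ₁ - ρ₂) x ∂(spaceMeasure Ω))
        + c * ∫ x, ‖(m₁ - m₂) x‖ ^ sExp α ∂(spaceMeasure Ω)
      ≤ C * δ ^ sStar α * ((spaceMeasure Ω).real univ
        + ∫ x, ‖m₂ x‖ ^ sExp α ∂(spaceMeasure Ω)) := by
  have hcj := hα.holderConjugate hN
  have hV := h₁.memV.sub (by linarith [hα.two_lt_sExp hN]) h₂.memV
  have hρ := h₁.memLp_ρ.sub h₂.memLp_ρ
  have hmp := integrable_rpow_norm hcj.pos hV.memLp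
  have hmp₂ := integrable_rpow_norm hcj.pos h₂.memV.memLp
  have hF₁ := hα.integrable_inner_genPoly hN h₁.measurable_a h₁.bounds h₁.memV.memLp hV.memLp
  have hF₂ := hα.integrable_inner_genPoly hN h₂.measurable_a h₂.bounds h₂.memV.memLp hV.memLp
  have e1 := h₁.momentum _ _ hV
  have e2 := h₂.momentum _ _ hV
  have e3 := h₁.mass _ hρ
  have e4 := h₂.mass _ hρ
  have e5 : ∫ x, φ x * (r₁ - r₂) x * (ρ₁ - ρ₂) x ∂(spaceMeasure Ω)
      = (∫ x, φ x * r₁ x * (ρ₁ - ρ₂) x ∂(spaceMeasure Ω))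
        - ∫ x, φ x * r₂ x * (ρ₁ - ρ₂) x ∂(spaceMeasure Ω) := by
    rw [← integral_sub (integrable_weight_mul hφ hB h₁.memLp_r hρ)
      (integrable_weight_mul hφ hB h₂.memLp_r hρ)]
    refine integral_congr_ae (Filter.Eventually.of_forall fun x => ?_)
    simp only [Pi.sub_apply]
    ring
  have hI : ∀ {u v : E d → ℝ}, MemLp u 2 (spaceMeasure Ω) → MemLp v 2 (spaceMeasure Ω) →
      Integrable (fun x => u x * v x) (spaceMeasure Ω) := fun hu hv => hu.integrable_mul hv
  -- Both sides are `(ρ₁ - ρ₂, w₁ - w₂)`: the divergence terms of the two difference equations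
  -- cancel.
  have e6 : (∫ x, ρ₁ x * (w₁ - w₂) x ∂(spaceMeasure Ω)) - ∫ x, ρ₂ x * (w₁ - w₂) x ∂(spaceMeasure Ω)
      = (∫ x, w₁ x * (ρ₁ - ρ₂) x ∂(spaceMeasure Ω))
        - ∫ x, w₂ x * (ρ₁ - ρ₂) x ∂(spaceMeasure Ω) := by
    rw [← integral_sub (hI h₁.memLp_ρ hV.memLp_div) (hI h₂.memLp_ρ hV.memLp_div),
      ← integral_sub (hI h₁.memV.memLp_div hρ) (hI h₂.memV.memLp_div hρ)]
    refine integral_congr_ae (Filter.Eventually.of_forall fun x => ?_)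
    simp only [Pi.sub_apply]
    ring
  have i1 : c * (∫ x, ‖(m₁ - m₂) x‖ ^ sExp α ∂(spaceMeasure Ω))
      - C * δ ^ sStar α * ((spaceMeasure Ω).real univ
        + ∫ x, ‖m₂ x‖ ^ sExp α ∂(spaceMeasure Ω))
      ≤ (∫ x, inner ℝ (genPoly α (a₁ x) ‖m₁ x‖ • m₁ x) ((m₁ - m₂) x) ∂(spaceMeasure Ω))
        - ∫ x, inner ℝ (genPoly α (a₂ x) ‖m₂ x‖ • m₂ x) ((m₁ - m₂) x) ∂(spaceMeasure Ω) := by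
    have hone : (spaceMeasure Ω).real univ = ∫ _x, (1 : ℝ) ∂(spaceMeasure Ω) := by simp
    have hr : Integrable (fun x => C * δ ^ sStar α * (1 + ‖m₂ x‖ ^ sExp α)) (spaceMeasure Ω) :=
      ((integrable_const (1 : ℝ)).add hmp₂).const_mul (C * δ ^ sStar α)
    rw [hone, ← integral_add (integrable_const _) hmp₂, ← integral_const_mul,
      ← integral_const_mul, ← integral_sub (hmp.const_mul c) hr, ← integral_sub hF₁ hF₂]
    refine integral_mono_ae ((hmp.const_mul c).sub hr) (hF₁.sub hF₂) ?_
    filter_upwards [h₁.bounds, h₁.lower_bound, hδ] with x hx hx' hxδ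
    have := hc (a₁ x) (a₂ x) δ (m₁ x) (m₂ x) (fun i => (hx i).1) hx' hxδ
    rw [inner_sub_left] at this
    exact this
  linarith

end SliceEstimates


/-! ### A priori bound and continuous dependence -/

section Solutions

variable {T : ℝ} {Ω : Opens (E d)} {α : Fin (N + 2) → ℝ} {aLow aUp φLow φUp : ℝ} {K : ℝ≥0}
  {D : ProblemData d}

theorem integrable_sq_of_mixedNorm_sq_le {u : ℝ → E d → ℝ}
    (hu : JointlyMeasurable T Ω u) (h : mixedNorm T Ω 2 2 u ^ 2 ≤ K) :
    (∀ᵐ t ∂(timeMeasure T), MemLp (u t) 2 (spaceMeasure Ω)) ∧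
    Integrable (fun t => ∫ x, u t x ^ 2 ∂(spaceMeasure Ω)) (timeMeasure T) ∧
    ∫ t, ∫ x, u t x ^ 2 ∂(spaceMeasure Ω) ∂(timeMeasure T) ≤ K := by
  have := integrable_of_mixedNorm_rpow_le (p := 2) two_pos hu (K := K) (by simpa using h)
  simpa using this

theorem ProblemData.IsAdmissible.abs_φ_le (hD : D.IsAdmissible T Ω φLow φUp) (hφ : 0 < φLow) :
    ∀ᵐ x ∂(spaceMeasure Ω), |D.φ x| ≤ |φUp| := by
  filter_upwards [hD.bounds_φ] with x hx
  exact abs_le_abs_of_nonneg (hφ.le.trans hx.1) hx.2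

theorem ProblemData.IsAdmissible.memLp_ρ₀ (hD : D.IsAdmissible T Ω φLow φUp)
    (hK : D.size T Ω α ≤ K) :
    MemLp D.ρ₀ 2 (spaceMeasure Ω) ∧ ∫ x, D.ρ₀ x ^ 2 ∂(spaceMeasure Ω) ≤ K := by
  have h1 : eLpNorm D.ρ₀ 2 (spaceMeasure Ω) ^ 2 ≤ K := by
    refine le_trans ?_ hK
    unfold ProblemData.size
    rw [add_assoc, add_assoc]
    exact le_self_add
  have hm : MemLp D.ρ₀ 2 (spaceMeasure Ω) := by
    refine ⟨hD.measurable_ρ₀, lt_top_iff_ne_top.2 fun h => ?_⟩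
    rw [h] at h1
    simp at h1
  refine ⟨hm, ?_⟩
  rw [eLpNorm_two_sq hm, ← ENNReal.ofReal_coe_nnreal, ENNReal.ofReal_le_ofReal_iff K.coe_nonneg] at h1
  exact h1

theorem IsWeakSolution.memLp_zero {a : ℝ → E d → Fin (N + 2) → ℝ} {m : ℝ → E d → E d}
    {ρ : ℝ → E d → ℝ} (h : IsWeakSolution T Ω α D a m ρ)
    (h0 : MemLp D.ρ₀ 2 (spaceMeasure Ω)) : MemLp (ρ 0) 2 (spaceMeasure Ω) :=
  (memLp_congr_ae h.initial).2 h0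

theorem IsWeakSolution.exists_slices {a : ℝ → E d → Fin (N + 2) → ℝ} {m : ℝ → E d → E d}
    {ρ : ℝ → E d → ℝ} (h : IsWeakSolution T Ω α D a m ρ) (ha : IsCoefficient T Ω aLow aUp a)
    (h0 : MemLp D.ρ₀ 2 (spaceMeasure Ω)) :
    ∃ ρt : ℝ → E d → ℝ, IsTimeDerivative T Ω ρ ρt ∧ ∀ᵐ t ∂(timeMeasure T), ∃ w : E d → ℝ,
      IsSliceSolution Ω α aLow aUp D.φ (D.f t) (D.Ψt t) (D.gradΨ t) (a t) (m t) w (ρ t) (ρt t) := by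
  obtain ⟨ρt, hρt, heq⟩ := h.equations
  refine ⟨ρt, hρt, ?_⟩
  -- Only the membership `ρ t ∈ L²` is needed here, so the weight is irrelevant and is taken to be
  -- `0`.
  obtain ⟨S, hS⟩ := (hρt.energy (h.memLp_zero h0) (φ := 0) (B := 0)
    aestronglyMeasurable_const (by simp)).1
  filter_upwards [heq, hρt.memLp, ae_restrict_mem measurableSet_Icc, ha.measurable.prodMk_left,
    Measure.ae_ae_of_ae_prod ha.bounds] with t ⟨w, hw, h1, h2⟩ hr ht ham hab
  exact ⟨w, ham, hab.mono fun x hx => hx.1, hab.mono fun x hx => hx.2.2.2, hw, (hS t ht).1, hr,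
    h1, h2⟩

variable [IsFiniteMeasure (spaceMeasure Ω)]

/-- The a priori bound of the flux in `Lˢ(I, Lˢ(Ω))`. -/
theorem exists_flux_bound (hT : 0 < T) (hN : 1 ≤ N) (hα : IsExponentVector α)
    (ha : 0 < aLow) (hφ : 0 < φLow) (aUp φUp : ℝ) (K : ℝ≥0) :
    ∃ C : ℝ, 0 < C ∧ ∀ D : ProblemData d, D.IsAdmissible T Ω φLow φUp → D.size T Ω α ≤ K →
      ∀ (a : ℝ → E d → Fin (N + 2) → ℝ) (m : ℝ → E d → E d) (ρ : ℝ → E d → ℝ),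
        IsCoefficient T Ω aLow aUp a → IsWeakSolution T Ω α D a m ρ →
        Integrable (fun t => ∫ x, ‖m t x‖ ^ sExp α ∂(spaceMeasure Ω)) (timeMeasure T) ∧
        ∫ t, ∫ x, ‖m t x‖ ^ sExp α ∂(spaceMeasure Ω) ∂(timeMeasure T) ≤ C := by
  have hcj := hα.holderConjugate hN
  obtain ⟨C₁, hC₁, hY⟩ := exists_young hcj (half_pos ha)
  set B := |φUp|
  have hB0 : 0 ≤ B := abs_nonneg _
  -- Over `I` the term `η S` integrates to `φLow / 4 * S`; the factor `2` of the energy identity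
  -- makes it `φLow / 2 * S`, half of what the left side controls.
  set η : ℝ := φLow / (4 * T) with hη
  have hηpos : 0 < η := by positivity
  set A : ℝ := B * K + 2 * (C₁ * K + (2 * η)⁻¹ * (K + B ^ 2 * K))
  have hA0 : 0 ≤ A := by positivity
  -- The summand `1` keeps the constant positive when `A = 0`.
  refine ⟨2 * A / aLow + 1, by positivity, fun D hD hK a m ρ hca hsol => ?_⟩
  obtain ⟨hρ₀, hρ₀K⟩ := hD.memLp_ρ₀ hK
  obtain ⟨ρt, hρt, hsl⟩ := hsol.exists_slices hca hρ₀
  have hBφ := hD.abs_φ_le hφ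
  obtain ⟨⟨S₀, hS₀⟩, hh, hen⟩ := hρt.energy (hsol.memLp_zero hρ₀) hD.measurable_φ hBφ
  have hKf : mixedNorm T Ω 2 2 D.f ^ 2 ≤ K := by
    refine le_trans ?_ hK
    unfold ProblemData.size
    exact le_add_right (le_add_right le_add_self)
  have hKψ : mixedNorm T Ω 2 2 D.Ψt ^ 2 ≤ K := by
    refine le_trans ?_ hK
    unfold ProblemData.size
    exact le_add_right le_add_self
  have hKg : mixedNorm T Ω (ENNReal.ofReal (sStar α)) (ENNReal.ofReal (sStar α)) D.gradΨ ^ sStar α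
      ≤ K := by
    refine le_trans ?_ hK
    unfold ProblemData.size
    exact le_add_self
  obtain ⟨hf1, hf2, hf3⟩ := integrable_sq_of_mixedNorm_sq_le hD.measurable_f hKf
  obtain ⟨hψ1, hψ2, hψ3⟩ := integrable_sq_of_mixedNorm_sq_le hD.timeDerivative_Ψ.measurable hKψ
  obtain ⟨hg1, hg2, hg3⟩ := integrable_of_mixedNorm_rpow_le hcj.symm.pos hD.measurable_gradΨ hKg
  set R : Set ℝ := (fun t => ∫ x, ρ t x ^ 2 ∂(spaceMeasure Ω)) '' Icc 0 T
  have hRne : R.Nonempty := ⟨_, 0, ⟨le_rfl, hT.le⟩, rfl⟩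
  have hRbdd : BddAbove R := by
    refine ⟨S₀, ?_⟩
    rintro _ ⟨t, ht, rfl⟩
    exact (hS₀ t ht).2
  set S := sSup R
  have hle : ∀ t ∈ Icc 0 T, ∫ x, ρ t x ^ 2 ∂(spaceMeasure Ω) ≤ S := fun t ht =>
    le_csSup hRbdd ⟨t, ht, rfl⟩
  have hS0 : 0 ≤ S := (integral_nonneg fun x => sq_nonneg _).trans (hle 0 ⟨le_rfl, hT.le⟩)
  set g : ℝ → ℝ := fun t => C₁ * (∫ x, ‖D.gradΨ t x‖ ^ sStar α ∂(spaceMeasure Ω))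
    + (2 * η)⁻¹ * ((∫ x, D.f t x ^ 2 ∂(spaceMeasure Ω))
      + B ^ 2 * ∫ x, D.Ψt t x ^ 2 ∂(spaceMeasure Ω)) + η * S with hg
  have hgi1 := hg2.const_mul C₁
  have hgi2 : Integrable (fun t => (2 * η)⁻¹ * ((∫ x, D.f t x ^ 2 ∂(spaceMeasure Ω))
      + B ^ 2 * ∫ x, D.Ψt t x ^ 2 ∂(spaceMeasure Ω))) (timeMeasure T) :=
    (hf2.add (hψ2.const_mul (B ^ 2))).const_mul (2 * η)⁻¹
  have hgi12 : Integrable (fun t => C₁ * (∫ x, ‖D.gradΨ t x‖ ^ sStar α ∂(spaceMeasure Ω))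
      + (2 * η)⁻¹ * ((∫ x, D.f t x ^ 2 ∂(spaceMeasure Ω))
        + B ^ 2 * ∫ x, D.Ψt t x ^ 2 ∂(spaceMeasure Ω))) (timeMeasure T) := hgi1.add hgi2
  have hgi : Integrable g (timeMeasure T) := hgi12.add (integrable_const _)
  have hgint : ∫ t, g t ∂(timeMeasure T)
      ≤ C₁ * K + (2 * η)⁻¹ * (K + B ^ 2 * K) + φLow / 4 * S := by
    have e1 : ∫ t, g t ∂(timeMeasure T)
        = C₁ * (∫ t, ∫ x, ‖D.gradΨ t x‖ ^ sStar α ∂(spaceMeasure Ω) ∂(timeMeasure T))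
        + (2 * η)⁻¹ * ((∫ t, ∫ x, D.f t x ^ 2 ∂(spaceMeasure Ω) ∂(timeMeasure T))
          + B ^ 2 * ∫ t, ∫ x, D.Ψt t x ^ 2 ∂(spaceMeasure Ω) ∂(timeMeasure T))
        + T * (η * S) := by
      have e0 : ∫ _t : ℝ, η * S ∂(timeMeasure T) = T * (η * S) := by
        simp [hT.le]
      rw [← e0, ← integral_const_mul (B ^ 2), ← integral_add hf2 (hψ2.const_mul _),
        ← integral_const_mul, ← integral_const_mul, ← integral_add hgi1 hgi2,
        ← integral_add hgi12 (integrable_const _)]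
    have e2 : T * (η * S) = φLow / 4 * S := by
      rw [hη]; field_simp
    rw [e1, e2]
    gcongr
  have hdiff : ∀ᵐ t ∂(timeMeasure T), (∫ x, D.φ x * ρt t x * ρ t x ∂(spaceMeasure Ω))
      + aLow / 2 * (∫ x, ‖m t x‖ ^ sExp α ∂(spaceMeasure Ω)) ≤ g t := by
    filter_upwards [hsl, hf1, hψ1, hg1, ae_restrict_mem measurableSet_Icc]
      with t ⟨w, hw⟩ hft hψt hgt htI
    refine (hw.energy_le hα hN hD.measurable_φ hBφ hft hψt hgt hηpos hY).trans ?_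
    simp only [hg]
    gcongr
    exact hle t htI
  obtain ⟨hp, hbt, hbT⟩ := integral_le_of_add_le hT.le (half_pos ha) hh hgi
    (aestronglyMeasurable_integral_rpow hsol.measurable_m)
    (fun t => integral_nonneg fun x => by positivity)
    (fun t => by
      have h1 : 0 ≤ ∫ x, ‖D.gradΨ t x‖ ^ sStar α ∂(spaceMeasure Ω) :=
        integral_nonneg fun x => by positivity
      have h2 : 0 ≤ ∫ x, D.f t x ^ 2 ∂(spaceMeasure Ω) := integral_nonneg fun x => sq_nonneg _
      have h3 : 0 ≤ ∫ x, D.Ψt t x ^ 2 ∂(spaceMeasure Ω) := integral_nonneg fun x => sq_nonneg _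
      positivity) hdiff
  have he0 : ∫ x, D.φ x * ρ 0 x ^ 2 ∂(spaceMeasure Ω) ≤ B * K := by
    calc ∫ x, D.φ x * ρ 0 x ^ 2 ∂(spaceMeasure Ω) ≤ ∫ x, B * D.ρ₀ x ^ 2 ∂(spaceMeasure Ω) := by
          refine integral_mono_ae ((hsol.memLp_zero hρ₀).integrable_sq.bdd_mul hD.measurable_φ hBφ)
            (hρ₀.integrable_sq.const_mul B) ?_
          filter_upwards [hBφ, hsol.initial] with x hx hx0
          rw [hx0]
          exact mul_le_mul_of_nonneg_right (le_of_abs_le hx) (sq_nonneg _)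
      _ = B * ∫ x, D.ρ₀ x ^ 2 ∂(spaceMeasure Ω) := integral_const_mul _ _
      _ ≤ B * K := by gcongr
  have hlow : ∀ t ∈ Icc 0 T, φLow * (∫ x, ρ t x ^ 2 ∂(spaceMeasure Ω))
      ≤ ∫ x, D.φ x * ρ t x ^ 2 ∂(spaceMeasure Ω) := by
    intro t ht
    rw [← integral_const_mul]
    refine integral_mono_ae ((hS₀ t ht).1.integrable_sq.const_mul _)
      ((hS₀ t ht).1.integrable_sq.bdd_mul hD.measurable_φ hBφ) ?_
    filter_upwards [hD.bounds_φ] with x hx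
    exact mul_le_mul_of_nonneg_right hx.1 (sq_nonneg _)
  -- The energy bound holds for every `t ∈ I`, hence for the supremum. As `S` is finite, absorption
  -- gives `φLow / 2 * S ≤ A`.
  have hSle : S ≤ (A + φLow / 2 * S) / φLow := by
    refine csSup_le hRne ?_
    rintro _ ⟨t, ht, rfl⟩
    rw [le_div_iff₀' hφ]
    have h1 := hlow t ht
    have h2 := hen t ht
    have h3 := hbt t ht
    simp only at h1 ⊢
    linarith
  rw [le_div_iff₀' hφ] at hSle
  refine ⟨hp, ?_⟩
  have hTI : T ∈ Icc 0 T := ⟨hT.le, le_rfl⟩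
  have h1 := hlow T hTI
  have h2 := hen T hTI
  have h3 : 0 ≤ φLow * ∫ x, ρ T x ^ 2 ∂(spaceMeasure Ω) :=
    mul_nonneg hφ.le (integral_nonneg fun x => sq_nonneg _)
  have h4 : aLow / 2 * (∫ t, ∫ x, ‖m t x‖ ^ sExp α ∂(spaceMeasure Ω) ∂(timeMeasure T)) ≤ A := by
    linarith
  have h5 : ∫ t, ∫ x, ‖m t x‖ ^ sExp α ∂(spaceMeasure Ω) ∂(timeMeasure T) ≤ 2 * A / aLow := by
    rw [le_div_iff₀' ha]
    linarith
  linarith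

/-- Continuous dependence on the coefficients, in terms of real-valued integrals. -/
theorem exists_continuous_dependence (hT : 0 < T) (hN : 1 ≤ N) (hα : IsExponentVector α)
    (ha : 0 < aLow) (hφ : 0 < φLow) (aUp φUp : ℝ) (K : ℝ≥0) :
    ∃ M₁ M₂ : ℝ, 0 < M₁ ∧ 0 < M₂ ∧
      ∀ D : ProblemData d, D.IsAdmissible T Ω φLow φUp → D.size T Ω α ≤ K →
      ∀ a₁ a₂ : ℝ → E d → Fin (N + 2) → ℝ,
        IsCoefficient T Ω aLow aUp a₁ → IsCoefficient T Ω aLow aUp a₂ →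
      ∀ (m₁ m₂ : ℝ → E d → E d) (ρ₁ ρ₂ : ℝ → E d → ℝ),
        IsWeakSolution T Ω α D a₁ m₁ ρ₁ → IsWeakSolution T Ω α D a₂ m₂ ρ₂ →
      ∀ δ : ℝ, 0 ≤ δ →
        (∀ᵐ t ∂(timeMeasure T), ∀ᵐ x ∂(spaceMeasure Ω), ‖a₁ t x - a₂ t x‖ ≤ δ) →
        (∀ t ∈ Icc 0 T, MemLp ((ρ₁ - ρ₂) t) 2 (spaceMeasure Ω) ∧
          ∫ x, (ρ₁ - ρ₂) t x ^ 2 ∂(spaceMeasure Ω) ≤ M₁ * δ ^ sStar α) ∧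
        (∀ᵐ t ∂(timeMeasure T), MemLp ((m₁ - m₂) t) (ENNReal.ofReal (sExp α)) (spaceMeasure Ω)) ∧
        Integrable (fun t => ∫ x, ‖(m₁ - m₂) t x‖ ^ sExp α ∂(spaceMeasure Ω)) (timeMeasure T) ∧
        ∫ t, ∫ x, ‖(m₁ - m₂) t x‖ ^ sExp α ∂(spaceMeasure Ω) ∂(timeMeasure T)
          ≤ M₂ * δ ^ sStar α := by
  have hcj := hα.holderConjugate hN
  obtain ⟨C₀, hC₀, hflux⟩ := exists_flux_bound (d := d) (Ω := Ω) hT hN hα ha hφ aUp φUp K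
  obtain ⟨c, C, hc, hC, hpert⟩ := hα.exists_perturbation_le (H := E d) hN ha
  set V : ℝ := (spaceMeasure Ω).real univ
  have hV0 : 0 ≤ V := measureReal_nonneg
  -- `L δ^(s*)` bounds the integral over `I × Ω` of the perturbation error `C δ^(s*) (1 + |m₂|^s)`.
  -- The `2` in `2 * L / φLow` comes from the energy identity.
  set L : ℝ := C * (T * V + C₀) with hL
  have hLpos : 0 < L := by positivity
  refine ⟨2 * L / φLow, L / c, by positivity, by positivity, ?_⟩
  intro D hD hK a₁ a₂ ha₁ ha₂ m₁ m₂ ρ₁ ρ₂ hs₁ hs₂ δ hδ0 hδ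
  obtain ⟨hρ₀, -⟩ := hD.memLp_ρ₀ hK
  obtain ⟨r₁, hr₁, hsl₁⟩ := hs₁.exists_slices ha₁ hρ₀
  obtain ⟨r₂, hr₂, hsl₂⟩ := hs₂.exists_slices ha₂ hρ₀
  have hBφ := hD.abs_φ_le hφ
  have hzero : (ρ₁ - ρ₂) 0 =ᵐ[spaceMeasure Ω] 0 := by
    filter_upwards [hs₁.initial, hs₂.initial] with x hx hx'
    simp [hx, hx']
  have hmem0 : MemLp ((ρ₁ - ρ₂) 0) 2 (spaceMeasure Ω) :=
    (hs₁.memLp_zero hρ₀).sub (hs₂.memLp_zero hρ₀)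
  obtain ⟨⟨S₀, hS₀⟩, hh, hen⟩ := (hr₁.sub hr₂).energy hmem0 hD.measurable_φ hBφ
  obtain ⟨hpi, hpC⟩ := hflux D hD hK a₂ m₂ ρ₂ ha₂ hs₂
  have he0 : ∫ x, D.φ x * (ρ₁ - ρ₂) 0 x ^ 2 ∂(spaceMeasure Ω) = 0 := by
    rw [integral_eq_zero_of_ae]
    filter_upwards [hzero] with x hx
    simp [hx]
  have hδs : 0 ≤ δ ^ sStar α := Real.rpow_nonneg hδ0 _
  set g : ℝ → ℝ := fun t => C * δ ^ sStar α * (V + ∫ x, ‖m₂ t x‖ ^ sExp α ∂(spaceMeasure Ω))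
    with hg
  have hgi : Integrable g (timeMeasure T) := ((integrable_const V).add hpi).const_mul _
  have hgint : ∫ t, g t ∂(timeMeasure T) ≤ L * δ ^ sStar α := by
    have e0 : ∫ _t : ℝ, V ∂(timeMeasure T) = T * V := by simp [hT.le]
    simp only [hg]
    rw [integral_const_mul, integral_add (integrable_const _) hpi, e0]
    calc _ ≤ C * δ ^ sStar α * (T * V + C₀) := by gcongr
      _ = _ := by rw [hL]; ring
  have hmem : ∀ᵐ t ∂(timeMeasure T),
      MemLp ((m₁ - m₂) t) (ENNReal.ofReal (sExp α)) (spaceMeasure Ω) := by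
    filter_upwards [hsl₁, hsl₂] with t ⟨w₁, h₁⟩ ⟨w₂, h₂⟩
    exact h₁.memV.memLp.sub h₂.memV.memLp
  have hdiff : ∀ᵐ t ∂(timeMeasure T),
      (∫ x, D.φ x * (r₁ - r₂) t x * (ρ₁ - ρ₂) t x ∂(spaceMeasure Ω))
        + c * (∫ x, ‖(m₁ - m₂) t x‖ ^ sExp α ∂(spaceMeasure Ω)) ≤ g t := by
    filter_upwards [hsl₁, hsl₂, hδ] with t ⟨w₁, h₁⟩ ⟨w₂, h₂⟩ hδt
    exact h₁.difference_le hα hN h₂ hD.measurable_φ hBφ hδt hpert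
  obtain ⟨hp, hbt, hbT⟩ := integral_le_of_add_le hT.le hc hh hgi
    (aestronglyMeasurable_integral_rpow (u := m₁ - m₂) (hs₁.measurable_m.sub hs₂.measurable_m))
    (fun t => integral_nonneg fun x => by positivity)
    (fun t => by
      have h1 : 0 ≤ ∫ x, ‖m₂ t x‖ ^ sExp α ∂(spaceMeasure Ω) :=
        integral_nonneg fun x => by positivity
      positivity) hdiff
  have hlow : ∀ t ∈ Icc 0 T, φLow * (∫ x, (ρ₁ - ρ₂) t x ^ 2 ∂(spaceMeasure Ω))
      ≤ ∫ x, D.φ x * (ρ₁ - ρ₂) t x ^ 2 ∂(spaceMeasure Ω) := by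
    intro t ht
    rw [← integral_const_mul]
    refine integral_mono_ae ((hS₀ t ht).1.integrable_sq.const_mul _)
      ((hS₀ t ht).1.integrable_sq.bdd_mul hD.measurable_φ hBφ) ?_
    filter_upwards [hD.bounds_φ] with x hx
    exact mul_le_mul_of_nonneg_right hx.1 (sq_nonneg _)
  refine ⟨fun t ht => ⟨(hS₀ t ht).1, ?_⟩, hmem, hp, ?_⟩
  · have h1 := hlow t ht
    have h2 := hen t ht
    have h3 := hbt t ht
    rw [div_mul_eq_mul_div, le_div_iff₀' hφ]
    linarith
  · have hTI : T ∈ Icc 0 T := ⟨hT.le, le_rfl⟩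
    have h1 := hlow T hTI
    have h2 := hen T hTI
    have h3 : 0 ≤ φLow * ∫ x, (ρ₁ - ρ₂) T x ^ 2 ∂(spaceMeasure Ω) :=
      mul_nonneg hφ.le (integral_nonneg fun x => sq_nonneg _)
    rw [div_mul_eq_mul_div, le_div_iff₀' hc]
    linarith

end Solutions

/-! ### Return to norms with values in `[0, ∞]` -/

theorem mixedNorm_top_two_sq_le {T : ℝ} {Ω : Opens (E d)} {u : ℝ → E d → ℝ} {M : ℝ}
    (h : ∀ t ∈ Icc 0 T, MemLp (u t) 2 (spaceMeasure Ω) ∧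
      ∫ x, u t x ^ 2 ∂(spaceMeasure Ω) ≤ M) :
    mixedNorm T Ω ∞ 2 u ^ 2 ≤ ENNReal.ofReal M := by
  have h1 : mixedNorm T Ω ∞ 2 u ≤ ENNReal.ofReal M ^ (1 / 2 : ℝ) := by
    unfold mixedNorm
    rw [eLpNorm_exponent_top]
    refine essSup_le_of_ae_le _ ?_
    filter_upwards [ae_restrict_mem measurableSet_Icc] with t ht
    rw [enorm_eq_self, one_div, ENNReal.le_rpow_inv_iff two_pos, ENNReal.rpow_two,
      eLpNorm_two_sq (h t ht).1]
    exact ENNReal.ofReal_le_ofReal (h t ht).2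
  calc mixedNorm T Ω ∞ 2 u ^ 2 ≤ (ENNReal.ofReal M ^ (1 / 2 : ℝ)) ^ 2 := by gcongr
    _ = ENNReal.ofReal M := by
      rw [← ENNReal.rpow_two, ← ENNReal.rpow_mul]
      simp

theorem ae_enorm_le_mixedNorm_top {F : Type*} [NormedAddCommGroup F] {T : ℝ} {Ω : Opens (E d)}
    (u : ℝ → E d → F) :
    ∀ᵐ t ∂(timeMeasure T), ∀ᵐ x ∂(spaceMeasure Ω), ‖u t x‖ₑ ≤ mixedNorm T Ω ∞ ∞ u := by
  unfold mixedNorm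
  have h := ae_le_eLpNormEssSup (f := fun t => eLpNorm (u t) ∞ (spaceMeasure Ω))
    (μ := timeMeasure T)
  filter_upwards [h] with t ht
  filter_upwards [ae_le_eLpNormEssSup (f := u t) (μ := spaceMeasure Ω)] with x hx
  rw [enorm_eq_self, eLpNorm_exponent_top] at ht
  rw [eLpNorm_exponent_top]
  exact hx.trans ht

end MixedRegimeFlow

open MixedRegimeFlow in
theorem mainTheorem8 (d : ℕ) (hd : 2 ≤ d)
    (Ω : TopologicalSpace.Opens (MixedRegimeFlow.E d))
    (hΩ : Bornology.IsBounded (Ω : Set (MixedRegimeFlow.E d)))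
    (T : ℝ) (hT : 0 < T) (N : ℕ) (hN : 1 ≤ N)
    (α : Fin (N + 2) → ℝ) (hα : MixedRegimeFlow.IsExponentVector α)
    (aLow aUp φLow φUp : ℝ) (ha : 0 < aLow) (hφ : 0 < φLow) (K : ℝ≥0) :
    ∃ C : ℝ, 0 < C ∧
      ∀ D : MixedRegimeFlow.ProblemData d, D.IsAdmissible T Ω φLow φUp → D.size T Ω α ≤ K →
      ∀ a₁ a₂ : ℝ → MixedRegimeFlow.E d → Fin (N + 2) → ℝ,
        MixedRegimeFlow.IsCoefficient T Ω aLow aUp a₁ →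
        MixedRegimeFlow.IsCoefficient T Ω aLow aUp a₂ →
      ∀ (m₁ m₂ : ℝ → MixedRegimeFlow.E d → MixedRegimeFlow.E d)
        (ρ₁ ρ₂ : ℝ → MixedRegimeFlow.E d → ℝ),
        MixedRegimeFlow.IsWeakSolution T Ω α D a₁ m₁ ρ₁ →
        MixedRegimeFlow.IsWeakSolution T Ω α D a₂ m₂ ρ₂ →
        MixedRegimeFlow.mixedNorm T Ω ∞ 2 (ρ₁ - ρ₂) ^ 2
            + MixedRegimeFlow.mixedNorm T Ω (ENNReal.ofReal (MixedRegimeFlow.sExp α))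
                (ENNReal.ofReal (MixedRegimeFlow.sExp α)) (m₁ - m₂) ^ MixedRegimeFlow.sExp α
          ≤ ENNReal.ofReal C
            * MixedRegimeFlow.mixedNorm T Ω ∞ ∞ (a₁ - a₂) ^ MixedRegimeFlow.sStar α := by
  have : IsFiniteMeasure (spaceMeasure Ω) :=
    ⟨by simpa only [Measure.restrict_apply_univ] using hΩ.measure_lt_top⟩
  have hcj := hα.holderConjugate hN
  obtain ⟨M₁, M₂, hM₁, hM₂, hM⟩ := exists_continuous_dependence (d := d) (Ω := Ω) hT hN hα ha hφ
    aUp φUp K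
  refine ⟨M₁ + M₂, by positivity, fun D hD hK a₁ a₂ ha₁ ha₂ m₁ m₂ ρ₁ ρ₂ hs₁ hs₂ => ?_⟩
  have hδ := ae_enorm_le_mixedNorm_top (T := T) (Ω := Ω) (a₁ - a₂)
  rcases eq_or_ne (mixedNorm T Ω ∞ ∞ (a₁ - a₂)) ∞ with htop | htop
  -- An infinite coefficient distance makes the right side infinite, because `s* > 0` and the
  -- constant is positive.
  · rw [htop, ENNReal.top_rpow_of_pos hcj.symm.pos, ENNReal.mul_top (by simp; positivity)]
    exact le_top
  set δ : ℝ := (mixedNorm T Ω ∞ ∞ (a₁ - a₂)).toReal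
  have hδ0 : 0 ≤ δ := ENNReal.toReal_nonneg
  have hδe : mixedNorm T Ω ∞ ∞ (a₁ - a₂) = ENNReal.ofReal δ := (ENNReal.ofReal_toReal htop).symm
  rw [hδe] at hδ
  obtain ⟨h1, h2, h3, h4⟩ := hM D hD hK a₁ a₂ ha₁ ha₂ m₁ m₂ ρ₁ ρ₂ hs₁ hs₂ δ hδ0
    (hδ.mono fun t ht => ht.mono fun x hx => by
      rwa [← ofReal_norm, ENNReal.ofReal_le_ofReal_iff hδ0] at hx)
  rw [mixedNorm_rpow_eq_ofReal hcj.pos h2 h3, hδe,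
    ENNReal.ofReal_rpow_of_nonneg hδ0 hcj.symm.nonneg, ← ENNReal.ofReal_mul (by positivity),
    add_mul, ENNReal.ofReal_add (by positivity) (by positivity)]
  exact add_le_add (mixedNorm_top_two_sq_le h1) (ENNReal.ofReal_le_ofReal h4)
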